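/- Let $(M,g)$ be a smooth non-compact Riemannian manifold (Hausdorff, second countable, without boundary) with Levi-Civita connection $\nabla$ and Riemannian measure $\nu$; let $1\le p<\infty$ and let $r\ge 1$ be an integer. For $f\in C^\infty(M)$ (real-valued) put $$\|f\|_{W^r_p}=\sum_{k=0}^r\Big(\int_M|\nabla^k f|^p\,d\nu\Big)^{1/p},$$ and let $W^r_p(M)$ be the completion of $\{f\in C^\infty(M):\|f\|_{W^r_p}<\infty\}$ with respect to this norm, regarded as a space of functions in $L^p(M)$. Let $$W^r_{p,loc}(M)=\{f\in L^1_{loc}(M):\ \eta f\in W^r_p(M)\ \text{ for all }\eta\in C_c^\infty(M)\},$$ where functions equal $\nu$-almost everywhere are identified. Then $W^r_{p,loc}(M)$ is a linear space, the maps $\varrho_\eta(f)=\|\eta f\|_{W^r_p(M)}$, $\eta\in C_c^\infty(M)$, are seminorms on it, and with the topology generated by these seminorms it is a Fréchet space (a complete metrizable locally convex topological vector space). Moreover, $C_c^\infty(M)$ is contained in $W^r_{p,loc}(M)$ and is dense in it. -/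

import Mathlib

open Set Filter Topology MeasureTheory
open scoped Manifold ContDiff ENNReal Bundle

noncomputable section

namespace LocSob

/-- The model space `ℝ^d`. -/
abbrev Model (d : ℕ) : Type := EuclideanSpace ℝ (Fin d)

/-- A smooth Riemannian metric on the boundaryless `d`-dimensional manifold `M`. -/
abbrev Metric (d : ℕ) (M : Type*) [TopologicalSpace M] [ChartedSpace (Model d) M]
    [IsManifold (𝓡 d) ∞ M] : Type _ :=
  Bundle.ContMDiffRiemannianMetric (𝓡 d) ∞ (Model d) (fun x : M => TangentSpace (𝓡 d) x)

variable {d : ℕ} {M : Type*} [TopologicalSpace M] [ChartedSpace (Model d) M]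
  [IsManifold (𝓡 d) ∞ M]

/-- The coordinate vector field `∂/∂xᵢ` of the chart `e`, at the point with coordinates `y`. -/
def coordVector (e : OpenPartialHomeomorph M (Model d)) (i : Fin d) (y : Model d) :
    TangentSpace (𝓡 d) (e.symm y) :=
  mfderiv (𝓡 d) (𝓡 d) e.symm y (EuclideanSpace.single i (1 : ℝ) : Model d)

/-- The matrix `(g_ij)` of the metric in the chart `e`, at the point with coordinates `y`. -/
def gram (g : Metric d M) (e : OpenPartialHomeomorph M (Model d)) (y : Model d) :
    Matrix (Fin d) (Fin d) ℝ :=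
  Matrix.of fun i j => g.inner (e.symm y) (coordVector e i y) (coordVector e j y)

/-- The partial derivative `∂F/∂xᵢ` at `y`. -/
def pderiv (i : Fin d) (F : Model d → ℝ) (y : Model d) : ℝ :=
  fderiv ℝ F y (EuclideanSpace.single i (1 : ℝ))

/-- The Christoffel symbol `Γ^a_ij` of the Levi-Civita connection of `g` in the chart `e`. -/
def christoffel (g : Metric d M) (e : OpenPartialHomeomorph M (Model d)) (a i j : Fin d)
    (y : Model d) : ℝ :=
  (1 / 2) * ∑ m, (gram g e y)⁻¹ a m *
    (pderiv i (fun z => gram g e z m j) y + pderiv j (fun z => gram g e z m i) y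
      - pderiv m (fun z => gram g e z i j) y)

/-- The components `∇^k f (x)_{i₁ … i_k}` of the `k`-th covariant derivative of `f` in the chart
`e`, as functions of the coordinates `y` of `x`:
`∇^{k+1} f_{i₀ i₁ … i_k} = ∂_{i₀} (∇^k f_{i₁ … i_k}) - ∑_l ∑_a Γ^a_{i₀ i_l} ∇^k f_{i₁ … a … i_k}`,
with `a` in the `l`-th place. -/
def covDeriv (g : Metric d M) (e : OpenPartialHomeomorph M (Model d)) (f : M → ℝ) :
    (k : ℕ) → (Fin k → Fin d) → Model d → ℝ
  | 0, _, y => f (e.symm y)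
  | k + 1, i, y => pderiv (i 0) (covDeriv g e f k (Fin.tail i)) y
      - ∑ l : Fin k, ∑ a : Fin d, christoffel g e a (i 0) (Fin.tail i l) y *
          covDeriv g e f k (Function.update (Fin.tail i) l a) y

/-- The pointwise norm `|∇^k f|(x)` of the `k`-th covariant derivative of a smooth function,
`|∇^k f|² = ∑_{i,j} g^{i₁ j₁} ⋯ g^{i_k j_k} ∇^k f_{i₁ … i_k} ∇^k f_{j₁ … j_k}`.
It does not depend on the chart at `x`; it is computed here in the preferred chart at `x`. -/
def covDerivNorm (g : Metric d M) (k : ℕ) (f : M → ℝ) (x : M) : ℝ :=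
  let e := chartAt (Model d) x
  √(∑ i : Fin k → Fin d, ∑ j : Fin k → Fin d,
    (∏ l, (gram g e (e x))⁻¹ (i l) (j l)) * covDeriv g e f k i (e x) * covDeriv g e f k j (e x))

section Measure

variable [MeasurableSpace M]

/-- The measure `√(det g_ij) dy` of the chart `e`, carried to the domain of `e` in `M`. -/
def chartMeasure (g : Metric d M) (e : OpenPartialHomeomorph M (Model d)) : Measure M :=
  (((volume : Measure (Model d)).restrict e.target).withDensity
    (fun y => ENNReal.ofReal √(gram g e y).det)).map e.symm

/-- The Riemannian measure `ν` of `g`. By the change of variables formula the chart measures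
agree on overlaps of charts; `ν` is the measure that restricts to `√(det g_ij) dy` in every chart.
As the charts cover `M`, it is the least upper bound of the chart measures in the complete
lattice of measures on `M`. -/
def riemannianMeasure (g : Metric d M) : Measure M :=
  ⨆ e ∈ atlas (Model d) M, chartMeasure g e

/-- The norm `‖f‖_{W^r_p} = ∑_{k=0}^r (∫ |∇^k f|^p dν)^{1/p}` of a smooth function `f`,
possibly infinite. -/
def smoothSobolevNorm (g : Metric d M) (r : ℕ) (p : ℝ≥0∞) (f : C^∞⟮𝓡 d, M; ℝ⟯) : ℝ≥0∞ :=
  ∑ k ∈ Finset.range (r + 1), eLpNorm (covDerivNorm g k f) p (riemannianMeasure g)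

/-- The sequence `u` represents `f` as an element of the completion of
`{u ∈ C^∞(M) : ‖u‖_{W^r_p} < ∞}`, realized as a space of functions in `L^p`: `u` is a Cauchy
sequence for the norm of `W^r_p`, and it converges to `f` in `L^p`. -/
structure IsSobolevApprox (g : Metric d M) (r : ℕ) (p : ℝ≥0∞) (u : ℕ → C^∞⟮𝓡 d, M; ℝ⟯)
    (f : M → ℝ) : Prop where
  finite : ∀ n, smoothSobolevNorm g r p (u n) < ⊤
  cauchy : ∀ ε : ℝ≥0∞, 0 < ε → ∃ N, ∀ m ≥ N, ∀ n ≥ N, smoothSobolevNorm g r p (u m - u n) ≤ ε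
  measurable : AEStronglyMeasurable f (riemannianMeasure g)
  tendsto : Tendsto (fun n => eLpNorm (fun x => u n x - f x) p (riemannianMeasure g)) atTop (𝓝 0)

/-- Membership in the Sobolev space `W^r_p(M)`, the completion of the smooth functions with finite
norm. -/
def MemSobolev (g : Metric d M) (r : ℕ) (p : ℝ≥0∞) (f : M → ℝ) : Prop :=
  ∃ u, IsSobolevApprox g r p u f

/-- The norm of `f` in the completion `W^r_p(M)`: the limit of `‖u_n‖_{W^r_p}` for a sequence `u`
that represents `f`, and `∞` if there is none. All such `u` have the same limit, since a Cauchy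
sequence for `W^r_p` that tends to `0` in `L^p` tends to `0` in `W^r_p`; so the infimum over `u`
is the common value. -/
def sobolevNorm (g : Metric d M) (r : ℕ) (p : ℝ≥0∞) (f : M → ℝ) : ℝ≥0∞ :=
  ⨅ (u : ℕ → C^∞⟮𝓡 d, M; ℝ⟯) (_ : IsSobolevApprox g r p u f),
    limsup (fun n => smoothSobolevNorm g r p (u n)) atTop

/-- The local Sobolev space `W^r_{p,loc}(M)`, a set of classes of functions modulo equality almost
everywhere: the `f ∈ L^1_loc(M)` with `η f ∈ W^r_p(M)` for all `η ∈ C_c^∞(M)`. -/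
def localSobolev (g : Metric d M) (r : ℕ) (p : ℝ≥0∞) : Set (M →ₘ[riemannianMeasure g] ℝ) :=
  {f | LocallyIntegrable f (riemannianMeasure g) ∧
    ∀ η : C^∞⟮𝓡 d, M; ℝ⟯, HasCompactSupport η → MemSobolev g r p (fun x => η x * f x)}

end Measure

variable (d M) in
/-- The space `C_c^∞(M)` of test functions. -/
abbrev TestFunction : Type _ := {η : C^∞⟮𝓡 d, M; ℝ⟯ // HasCompactSupport η}

/-- A Fréchet space: a locally convex topological vector space that is metrizable and complete
(for the uniform structure of its additive group). -/
structure IsFrechetSpace (E : Type*) [AddCommGroup E] [Module ℝ E] [UniformSpace E] : Prop where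
  isUniformAddGroup : IsUniformAddGroup E
  continuousSMul : ContinuousSMul ℝ E
  locallyConvexSpace : LocallyConvexSpace ℝ E
  metrizableSpace : TopologicalSpace.MetrizableSpace E
  completeSpace : CompleteSpace E

end LocSob

end

/-! Everything rests on one estimate: for `η ∈ C_c^∞(M)`, multiplication by `η` is bounded on
`W^r_p` (`exists_sobolevNorm_mul_le`, from the pointwise Leibniz bound
`exists_covDerivNorm_mul_le`). Take a compact exhaustion `K n` and cutoffs `χ n` equal to `1` on `K
n`. Since `η = η χ n` for large `n`, the seminorm of `η` is at most a constant times that of `χ n`,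
so the countable family of the `χ n` gives the same topology. It separates points because the
Sobolev norm dominates the `L^p` norm. This yields metrizability.

Completeness: if `f n` is Cauchy, then for each `k` the functions `χ k * f n` converge to some `G
k`, as `W^r_p` is complete (`exists_limit_of_cauchy`). Both `χ k * G l` and `χ l * G k` are limits
of `χ k * χ l * f n`, so the `G k` glue to one function `h` with `χ k * h = G k` almost everywhere
(`exists_local_limit`). Density: approximate `χ n * f` by a smooth `u n` within `2⁻¹ ^ n`; then `χ n
* u n` is a test function and the sequence tends to `f` (`exists_testFunction_tendsto`).

The geometric input is that `|∇^k f|` can be computed in any chart (`covDerivNorm_eq`), hence is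
continuous, and that the Riemannian measure is finite on compact sets. The former follows from the
transformation law of the Christoffel symbols, the latter from the change of variables formula. The
norm of the completion enters only as an infimum over representing sequences; its independence of
the sequence is never needed. -/

noncomputable section

namespace LocSob

set_option maxSynthPendingDepth 3
set_option linter.unusedSectionVars false

/-! ### Covariant derivatives on a vector space with a connection, and their naturality -/

section Tensor

variable {E : Type*} [NormedAddCommGroup E] [NormedSpace ℝ E]

/-- The action of an endomorphism on multilinear forms as a derivation, `(A, T) ↦ A · T`. -/
def derivAction (E : Type*) [NormedAddCommGroup E] [NormedSpace ℝ E] (k : ℕ) :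
    (E →L[ℝ] E) →L[ℝ] (E [×k]→L[ℝ] ℝ) →L[ℝ] (E [×k]→L[ℝ] ℝ) :=
  -- Composition `T ∘ (A₁, …, A_k)` is multilinear in the `A`'s; varying slot `l` alone, with the
  -- identity elsewhere, gives the `l`-th term together with its continuity in `A` and `T`.
  ∑ l : Fin k, (ContinuousMultilinearMap.compContinuousLinearMapContinuousMultilinear ℝ
    (fun _ : Fin k => E) (fun _ : Fin k => E) ℝ).toContinuousLinearMap
      (fun _ => ContinuousLinearMap.id ℝ E) l

theorem derivAction_apply {k : ℕ} (A : E →L[ℝ] E) (T : E [×k]→L[ℝ] ℝ) (v : Fin k → E) :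
    derivAction E k A T v = ∑ l, T (Function.update v l (A (v l))) := by
  simp only [derivAction, sum_apply,
    ContinuousMultilinearMap.toContinuousLinearMap_apply,
    ContinuousMultilinearMap.compContinuousLinearMapContinuousMultilinear_apply_apply,
    ContinuousMultilinearMap.compContinuousLinearMap_apply]
  refine Finset.sum_congr rfl fun l _ => ?_
  congr 1
  ext1 i
  by_cases h : i = l
  · subst h; simp
  · simp [h]

/-- The iterated covariant derivatives of a function `F` with respect to the connection on a
vector space with Christoffel symbols `Γ`. -/
def covTensor (Γ : E → E →L[ℝ] E →L[ℝ] E) (F : E → ℝ) : (k : ℕ) → E → E [×k]→L[ℝ] ℝ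
  | 0, y => ContinuousMultilinearMap.uncurry0 ℝ E (F y)
  | k + 1, y => (continuousMultilinearCurryLeftEquiv ℝ (fun _ : Fin (k + 1) => E) ℝ).symm
      (fderiv ℝ (covTensor Γ F k) y - ((derivAction E k).flip (covTensor Γ F k y)).comp (Γ y))

theorem covTensor_succ_apply (Γ : E → E →L[ℝ] E →L[ℝ] E) (F : E → ℝ) (k : ℕ) (y : E)
    (v : Fin (k + 1) → E) :
    covTensor Γ F (k + 1) y v = fderiv ℝ (covTensor Γ F k) y (v 0) (Fin.tail v)
      - ∑ l, covTensor Γ F k y (Function.update (Fin.tail v) l (Γ y (v 0) (Fin.tail v l))) := by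
  rw [← derivAction_apply]; rfl

theorem contDiffOn_covTensor {Γ : E → E →L[ℝ] E →L[ℝ] E} {F : E → ℝ} {U : Set E} (hU : IsOpen U)
    (hΓ : ContDiffOn ℝ ∞ Γ U) (hF : ContDiffOn ℝ ∞ F U) (k : ℕ) :
    ContDiffOn ℝ ∞ (covTensor Γ F k) U := by
  induction k with
  | zero =>
    exact (continuousMultilinearCurryFin0 ℝ E ℝ).symm.contDiff.comp_contDiffOn hF
  | succ k ih =>
    refine (continuousMultilinearCurryLeftEquiv ℝ
      (fun _ : Fin (k + 1) => E) ℝ).symm.contDiff.comp_contDiffOn ?_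
    refine (ih.fderiv_of_isOpen hU (by simp)).sub ?_
    exact ((derivAction E k).flip.contDiff.comp_contDiffOn ih).clm_comp hΓ

/-- Induction on `k`: differentiating the pullback of a tensor gives the pullback of its derivative
plus one term with the second derivative of `Ψ` for each slot. The compatibility `hΓΓ` of the two
connections says that the correction terms of `Γ'` cancel exactly these. -/
theorem covTensor_comp {E' : Type*} [NormedAddCommGroup E'] [NormedSpace ℝ E']
    {Γ : E → E →L[ℝ] E →L[ℝ] E} {F : E → ℝ} {V : Set E} (hV : IsOpen V)
    (hΓ : ContDiffOn ℝ ∞ Γ V) (hF : ContDiffOn ℝ ∞ F V)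
    {Γ' : E' → E' →L[ℝ] E' →L[ℝ] E'} {F' : E' → ℝ} {U : Set E'} (hU : IsOpen U)
    {Ψ : E' → E} (hΨ : ContDiffOn ℝ ∞ Ψ U) (hmap : MapsTo Ψ U V)
    (hFF : ∀ y ∈ U, F' y = F (Ψ y))
    (hΓΓ : ∀ y ∈ U, ∀ v w, fderiv ℝ Ψ y (Γ' y v w) =
      fderiv ℝ (fderiv ℝ Ψ) y v w + Γ (Ψ y) (fderiv ℝ Ψ y v) (fderiv ℝ Ψ y w))
    (k : ℕ) {y : E'} (hy : y ∈ U) :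
    covTensor Γ' F' k y = (covTensor Γ F k (Ψ y)).compContinuousLinearMap
      (fun _ => fderiv ℝ Ψ y) := by
  induction k generalizing y with
  | zero => ext v; exact hFF y hy
  | succ k ih =>
    ext v
    have hΨ1 : HasFDerivAt Ψ (fderiv ℝ Ψ y) y :=
      ((hΨ.contDiffAt (hU.mem_nhds hy)).differentiableAt (by simp)).hasFDerivAt
    have hΨ2 : HasFDerivAt (fderiv ℝ Ψ) (fderiv ℝ (fderiv ℝ Ψ) y) y :=
      (((hΨ.fderiv_of_isOpen hU (m := ∞) (by simp)).contDiffAt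
        (hU.mem_nhds hy)).differentiableAt (by simp)).hasFDerivAt
    have hT : HasFDerivAt (covTensor Γ F k) (fderiv ℝ (covTensor Γ F k) (Ψ y)) (Ψ y) :=
      (((contDiffOn_covTensor hV hΓ hF k).contDiffAt
        (hV.mem_nhds (hmap hy))).differentiableAt (by simp)).hasFDerivAt
    have hder := HasFDerivAt.continuousMultilinearMapCompContinuousLinearMap (f := fun z => covTensor Γ F k (Ψ z)) (hT.comp y hΨ1)
      (g := fun (_ : Fin k) => fderiv ℝ Ψ) (fun _ => hΨ2)
    have heq : covTensor Γ' F' k =ᶠ[𝓝 y] fun z => (covTensor Γ F k (Ψ z)).compContinuousLinearMap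
        (fun _ => fderiv ℝ Ψ z) := by
      filter_upwards [hU.mem_nhds hy] with z hz using ih hz
    rw [covTensor_succ_apply, heq.fderiv_eq, hder.fderiv]
    simp only [ih hy, ContinuousMultilinearMap.compContinuousLinearMap_apply]
    rw [covTensor_succ_apply]
    simp only [add_apply, ContinuousLinearMap.comp_apply,
      ContinuousMultilinearMap.compContinuousLinearMapL_apply,
      ContinuousMultilinearMap.compContinuousLinearMap_apply]
    -- The correction in slot `l` splits into a second-derivative term, which the product rule also
    -- produces, and the pulled-back correction of `Γ`.
    have key : ∀ l : Fin k, covTensor Γ F k (Ψ y) (fun i => fderiv ℝ Ψ y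
        (Function.update (Fin.tail v) l (Γ' y (v 0) (Fin.tail v l)) i)) =
        covTensor Γ F k (Ψ y) (Function.update (fun i => fderiv ℝ Ψ y (Fin.tail v i)) l
          (fderiv ℝ (fderiv ℝ Ψ) y (v 0) (Fin.tail v l))) +
        covTensor Γ F k (Ψ y) (Function.update (fun i => fderiv ℝ Ψ y (Fin.tail v i)) l
          (Γ (Ψ y) (fderiv ℝ Ψ y (v 0)) (fderiv ℝ Ψ y (Fin.tail v l)))) := by
      intro l
      rw [← ContinuousMultilinearMap.map_update_add, ← hΓΓ y hy]
      congr 1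
      ext1 i
      by_cases h : i = l
      · subst h; simp
      · simp [h]
    simp only [key, Finset.sum_add_distrib]
    rw [ContinuousMultilinearMap.fderivCompContinuousLinearMap_apply]
    have h1 : ∀ l : Fin k, (fun j => Function.update (fun _ : Fin k => fderiv ℝ Ψ y) l
        (fderiv ℝ (fderiv ℝ Ψ) y (v 0)) j (Fin.tail v j)) =
        Function.update (fun i => fderiv ℝ Ψ y (Fin.tail v i)) l
          (fderiv ℝ (fderiv ℝ Ψ) y (v 0) (Fin.tail v l)) := by
      intro l
      ext1 j
      by_cases h : j = l
      · subst h; simp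
      · simp [h]
    have h2 : (Fin.tail fun i => fderiv ℝ Ψ y (v i)) = fun i => fderiv ℝ Ψ y (Fin.tail v i) := rfl
    simp only [ContinuousLinearMap.pi_apply, h1, h2]
    ring

end Tensor

/-! ### The metric in charts and under transition maps -/

section MetricForm
variable {d : ℕ} {M : Type*} [TopologicalSpace M] [ChartedSpace (Model d) M]
  [IsManifold (𝓡 d) ∞ M]

/-- The derivative of the inverse of a chart, as an endomorphism of the model space. -/
def chartDeriv (e : OpenPartialHomeomorph M (Model d)) (y : Model d) : Model d →L[ℝ] Model d :=
  mfderiv (𝓡 d) (𝓡 d) e.symm y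

/-- The metric at a point, as a bilinear form on the model space. -/
def metricAt (g : Metric d M) (x : M) : Model d →L[ℝ] Model d →L[ℝ] ℝ := g.inner x

theorem metricAt_comm (g : Metric d M) (x : M) (v w : Model d) :
    metricAt g x v w = metricAt g x w v := g.symm x v w

theorem metricAt_pos (g : Metric d M) (x : M) {v : Model d} (hv : v ≠ 0) :
    0 < metricAt g x v v := g.pos x v hv

/-- The metric in a chart, as a bilinear form on the model space. -/
def metricForm (g : Metric d M) (e : OpenPartialHomeomorph M (Model d)) (y : Model d) :
    Model d →L[ℝ] Model d →L[ℝ] ℝ :=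
  (metricAt g (e.symm y)).bilinearComp (chartDeriv e y) (chartDeriv e y)

theorem metricForm_apply (g : Metric d M) (e : OpenPartialHomeomorph M (Model d)) (y v w : Model d) :
    metricForm g e y v w = metricAt g (e.symm y) (chartDeriv e y v) (chartDeriv e y w) := rfl

theorem gram_apply (g : Metric d M) (e : OpenPartialHomeomorph M (Model d)) (y : Model d)
    (i j : Fin d) : gram g e y i j =
      metricForm g e y (EuclideanSpace.single i 1) (EuclideanSpace.single j 1) := rfl

theorem metricForm_comm (g : Metric d M) (e : OpenPartialHomeomorph M (Model d)) (y v w : Model d) :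
    metricForm g e y v w = metricForm g e y w v := by
  rw [metricForm_apply, metricForm_apply, metricAt_comm]

variable {e e' : OpenPartialHomeomorph M (Model d)}

theorem contMDiffOn_chart_of_mem_atlas (he : e ∈ atlas (Model d) M) :
    ContMDiffOn (𝓡 d) (𝓡 d) ∞ e e.source :=
  contMDiffOn_of_mem_maximalAtlas (StructureGroupoid.subset_maximalAtlas _ he)

theorem contMDiffOn_symm_of_mem_atlas (he : e ∈ atlas (Model d) M) :
    ContMDiffOn (𝓡 d) (𝓡 d) ∞ e.symm e.target :=
  contMDiffOn_symm_of_mem_maximalAtlas (StructureGroupoid.subset_maximalAtlas _ he)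

theorem mdifferentiableAt_symm_of_mem_atlas (he : e ∈ atlas (Model d) M) {y : Model d}
    (hy : y ∈ e.target) : MDifferentiableAt (𝓡 d) (𝓡 d) e.symm y :=
  ((contMDiffOn_symm_of_mem_atlas he).contMDiffAt
    (e.open_target.mem_nhds hy)).mdifferentiableAt (by simp)

theorem contDiffOn_comp_symm (he : e ∈ atlas (Model d) M) (f : C^∞⟮𝓡 d, M; ℝ⟯) :
    ContDiffOn ℝ ∞ (fun y => f (e.symm y)) e.target :=
  contMDiffOn_iff_contDiffOn.1 (f.contMDiff.comp_contMDiffOn (contMDiffOn_symm_of_mem_atlas he))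

theorem isOpen_transition (e e' : OpenPartialHomeomorph M (Model d)) :
    IsOpen (e'.target ∩ e'.symm ⁻¹' e.source) :=
  (e'.symm.trans e).open_source

theorem contDiffOn_transition (he : e ∈ atlas (Model d) M) (he' : e' ∈ atlas (Model d) M) :
    ContDiffOn ℝ ∞ (fun y => e (e'.symm y)) (e'.target ∩ e'.symm ⁻¹' e.source) :=
  contMDiffOn_iff_contDiffOn.1 ((contMDiffOn_chart_of_mem_atlas he).comp
    ((contMDiffOn_symm_of_mem_atlas he').mono inter_subset_left) fun _ h => h.2)

theorem hasFDerivAt_transition (he : e ∈ atlas (Model d) M) (he' : e' ∈ atlas (Model d) M)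
    {y : Model d} (hy : y ∈ e'.target ∩ e'.symm ⁻¹' e.source) :
    HasFDerivAt (fun y => e (e'.symm y)) (fderiv ℝ (fun y => e (e'.symm y)) y) y :=
  (((contDiffOn_transition he he').contDiffAt
    ((isOpen_transition e e').mem_nhds hy)).differentiableAt (by simp)).hasFDerivAt

theorem chartDeriv_transition (he : e ∈ atlas (Model d) M) (he' : e' ∈ atlas (Model d) M)
    {y : Model d} (hy : y ∈ e'.target ∩ e'.symm ⁻¹' e.source) :
    chartDeriv e' y =
      (chartDeriv e (e (e'.symm y))).comp (fderiv ℝ (fun y => e (e'.symm y)) y) := by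
  have h1 : MDifferentiableAt (𝓡 d) (𝓡 d) e.symm (e (e'.symm y)) :=
    mdifferentiableAt_symm_of_mem_atlas he (e.map_source hy.2)
  have h2 : MDifferentiableAt (𝓡 d) (𝓡 d) (fun y => e (e'.symm y)) y :=
    (hasFDerivAt_transition he he' hy).differentiableAt.mdifferentiableAt
  have h3 := mfderiv_comp y h1 h2
  rw [mfderiv_eq_fderiv] at h3
  have h4 : (e.symm ∘ fun y => e (e'.symm y)) =ᶠ[𝓝 y] e'.symm := by
    filter_upwards [(isOpen_transition e e').mem_nhds hy] with z hz using e.left_inv hz.2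
  rw [h4.mfderiv_eq] at h3
  exact h3

theorem chartDeriv_injective (he : e ∈ atlas (Model d) M) {y : Model d} (hy : y ∈ e.target) :
    Function.Injective (chartDeriv e y) := by
  have h1 : MDifferentiableAt (𝓡 d) (𝓡 d) e (e.symm y) :=
    ((contMDiffOn_chart_of_mem_atlas he).contMDiffAt
      (e.open_source.mem_nhds (e.map_target hy))).mdifferentiableAt (by simp)
  have h2 := mfderiv_comp y h1 (mdifferentiableAt_symm_of_mem_atlas he hy)
  have h3 : (e ∘ e.symm) =ᶠ[𝓝 y] id := by
    filter_upwards [e.open_target.mem_nhds hy] with z hz using e.right_inv hz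
  rw [h3.mfderiv_eq, mfderiv_id] at h2
  intro v w hvw
  have h4 := DFunLike.congr_fun h2 v
  have h5 := DFunLike.congr_fun h2 w
  have h6 : mfderiv (𝓡 d) (𝓡 d) e (e.symm y) (chartDeriv e y v) =
    mfderiv (𝓡 d) (𝓡 d) e (e.symm y) (chartDeriv e y w) := by rw [hvw]
  exact h4.trans (h6.trans h5.symm)

theorem metricForm_pos (g : Metric d M) (he : e ∈ atlas (Model d) M) {y : Model d}
    (hy : y ∈ e.target) {v : Model d} (hv : v ≠ 0) : 0 < metricForm g e y v v := by
  rw [metricForm_apply]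
  exact metricAt_pos g _ fun h => hv (chartDeriv_injective he hy (h.trans (map_zero _).symm))

theorem metricForm_transition (g : Metric d M) (he : e ∈ atlas (Model d) M)
    (he' : e' ∈ atlas (Model d) M) {y : Model d} (hy : y ∈ e'.target ∩ e'.symm ⁻¹' e.source)
    (v w : Model d) : metricForm g e' y v w = metricForm g e (e (e'.symm y))
      (fderiv ℝ (fun y => e (e'.symm y)) y v) (fderiv ℝ (fun y => e (e'.symm y)) y w) := by
  rw [metricForm_apply, metricForm_apply, chartDeriv_transition he he' hy, e.left_inv hy.2]
  rfl

/-- By the chain rule `chartDeriv_transition`, injectivity of the derivative of `e'.symm` passes to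
that of the transition map; dimensions agree. Surjectivity later allows testing against vectors in
the image only. -/
theorem fderiv_transition_surjective (he : e ∈ atlas (Model d) M) (he' : e' ∈ atlas (Model d) M)
    {y : Model d} (hy : y ∈ e'.target ∩ e'.symm ⁻¹' e.source) :
    Function.Surjective (fderiv ℝ (fun y => e (e'.symm y)) y) := by
  have hinj : Function.Injective (fderiv ℝ (fun y => e (e'.symm y)) y) := by
    intro v w hvw
    apply chartDeriv_injective he' hy.1
    rw [chartDeriv_transition he he' hy, ContinuousLinearMap.comp_apply,
      ContinuousLinearMap.comp_apply, hvw]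
  exact (LinearMap.injective_iff_surjective (f := (fderiv ℝ (fun y => e (e'.symm y)) y).toLinearMap)).1 hinj

/-- Smoothness of `g` is given for a section of a bundle. The coordinate fields are smooth sections
along `e.symm`, being its tangent map applied to constant fields, so inserting them into `g` gives
smooth scalar functions. -/
theorem contDiffOn_metricForm (g : Metric d M) (he : e ∈ atlas (Model d) M) :
    ContDiffOn ℝ ∞ (metricForm g e) e.target := by
  have hs : ContMDiffOn (𝓡 d) (𝓡 d) ∞ e.symm e.target := contMDiffOn_symm_of_mem_atlas he
  have hv : ∀ v : Model d, ContMDiffOn (𝓡 d) ((𝓡 d).prod (𝓡 d)) ∞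
      (fun y => (Bundle.TotalSpace.mk' (Model d) (e.symm y) (chartDeriv e y v) :
        TangentBundle (𝓡 d) M)) e.target := by
    intro v
    have h1 := hs.contMDiffOn_tangentMapWithin (m := ∞) (by simp)
      e.open_target.uniqueMDiffOn
    have h2 : ContMDiffOn (𝓡 d) ((𝓡 d).prod (𝓡 d)) ∞
        (fun y : Model d => (Bundle.TotalSpace.mk' (Model d) y v : TangentBundle (𝓡 d) (Model d)))
        e.target := contMDiffOn_vectorSpace_iff_contDiffOn.2 contDiffOn_const
    refine (h1.comp h2 fun y hy => hy).congr fun y hy => ?_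
    simp only [Function.comp_apply, tangentMapWithin, chartDeriv]
    rw [mfderivWithin_of_isOpen e.open_target hy]
    rfl
  refine contDiffOn_clm_apply.2 fun v => contDiffOn_clm_apply.2 fun w => ?_
  refine contMDiffOn_iff_contDiffOn.1 fun y hy => ?_
  have : ContMDiffWithinAt (𝓡 d) ((𝓡 d).prod 𝓘(ℝ)) ∞
      (fun m ↦ Bundle.TotalSpace.mk' ℝ (E := Bundle.Trivial M ℝ) (e.symm m)
        (g.inner (e.symm m) (chartDeriv e m v) (chartDeriv e m w))) e.target y := by
    apply ContMDiffWithinAt.clm_bundle_apply₂ (F₁ := Model d) (F₂ := Model d)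
    · exact ContMDiffAt.comp_contMDiffWithinAt y g.contMDiff.contMDiffAt (hs y hy)
    · exact hv v y hy
    · exact hv w y hy
  simp only [Bundle.contMDiffWithinAt_totalSpace] at this
  exact this.2

end MetricForm

/-! ### Christoffel symbols: Koszul formula and transformation law -/

section Christoffel
variable {d : ℕ} {M : Type*} [TopologicalSpace M] [ChartedSpace (Model d) M]
  [IsManifold (𝓡 d) ∞ M]
variable {e e' : OpenPartialHomeomorph M (Model d)}

theorem model_eq_sum (v : Model d) : v = ∑ i, v i • EuclideanSpace.single i (1 : ℝ) := by
  ext j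
  simp [Pi.single_apply]

theorem model_induction {P : Model d → Prop} (h0 : P 0)
    (hs : ∀ i, P (EuclideanSpace.single i 1)) (hadd : ∀ v w, P v → P w → P (v + w))
    (hsmul : ∀ (c : ℝ) v, P v → P (c • v)) (v : Model d) : P v := by
  rw [model_eq_sum v]
  exact Finset.sum_induction _ P hadd h0 fun i _ => hsmul _ _ (hs i)

theorem sum_single_mul_apply (L : Model d →L[ℝ] ℝ) (v : Model d) :
    ∑ i, v i * L (EuclideanSpace.single i 1) = L v := by
  conv_rhs => rw [model_eq_sum v]
  simp

theorem gram_mulVec_dotProduct (g : Metric d M) (e : OpenPartialHomeomorph M (Model d))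
    (y : Model d) (v w : Fin d → ℝ) :
    v ⬝ᵥ (gram g e y).mulVec w = metricForm g e y (WithLp.toLp 2 v) (WithLp.toLp 2 w) := by
  rw [← ContinuousLinearMap.flip_apply, ← sum_single_mul_apply]
  simp only [dotProduct, Matrix.mulVec, ContinuousLinearMap.flip_apply]
  refine Finset.sum_congr rfl fun i _ => ?_
  rw [← sum_single_mul_apply]
  simp only [gram_apply, mul_comm]

theorem gram_posDef (g : Metric d M) (he : e ∈ atlas (Model d) M) {y : Model d}
    (hy : y ∈ e.target) : (gram g e y).PosDef := by
  refine Matrix.PosDef.of_dotProduct_mulVec_pos ?_ fun v hv => ?_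
  · ext i j
    simp only [Matrix.conjTranspose_apply, gram_apply, star_trivial]
    exact metricForm_comm g e y _ _
  · rw [star_trivial, gram_mulVec_dotProduct]
    exact metricForm_pos g he hy (by simpa using hv)

theorem contDiffOn_gram (g : Metric d M) (he : e ∈ atlas (Model d) M) (i j : Fin d) :
    ContDiffOn ℝ ∞ (fun y => gram g e y i j) e.target :=
  ((contDiffOn_metricForm g he).clm_apply contDiffOn_const).clm_apply contDiffOn_const

theorem contDiffOn_gram_det (g : Metric d M) (he : e ∈ atlas (Model d) M) :
    ContDiffOn ℝ ∞ (fun y => (gram g e y).det) e.target := by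
  simp only [Matrix.det_apply]
  exact ContDiffOn.sum fun σ _ => ContDiffOn.const_smul _
    (contDiffOn_prod fun i _ => contDiffOn_gram g he _ _)

/-- Cramer's rule: each entry is a quotient of polynomials in the `g_ij`, and the denominator is
positive by positive definiteness. -/
theorem contDiffOn_gram_inv (g : Metric d M) (he : e ∈ atlas (Model d) M) (i j : Fin d) :
    ContDiffOn ℝ ∞ (fun y => (gram g e y)⁻¹ i j) e.target := by
  have h : ∀ y, (gram g e y)⁻¹ i j =
      ((gram g e y).det)⁻¹ * ((gram g e y).updateRow j (Pi.single i 1)).det := by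
    intro y
    rw [Matrix.inv_def, Matrix.smul_apply, Matrix.adjugate_apply, Ring.inverse_eq_inv', smul_eq_mul]
  simp only [h]
  refine ((contDiffOn_gram_det g he).inv fun y hy => (gram_posDef g he hy).det_pos.ne').mul ?_
  simp only [Matrix.det_apply]
  refine ContDiffOn.sum fun σ _ => ContDiffOn.const_smul _ (contDiffOn_prod fun a _ => ?_)
  by_cases ha : σ a = j
  · simp only [Matrix.updateRow_apply, ha, if_true]; exact contDiffOn_const
  · simp only [Matrix.updateRow_apply, ha, if_false]; exact contDiffOn_gram g he _ _

theorem contDiffOn_pderiv {F : Model d → ℝ} {U : Set (Model d)} (hU : IsOpen U)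
    (hF : ContDiffOn ℝ ∞ F U) (i : Fin d) : ContDiffOn ℝ ∞ (pderiv i F) U :=
  (hF.fderiv_of_isOpen hU (by simp)).clm_apply contDiffOn_const

theorem contDiffOn_christoffel (g : Metric d M) (he : e ∈ atlas (Model d) M) (a i j : Fin d) :
    ContDiffOn ℝ ∞ (christoffel g e a i j) e.target := by
  refine contDiffOn_const.mul (ContDiffOn.sum fun m _ => (contDiffOn_gram_inv g he a m).mul ?_)
  exact ((contDiffOn_pderiv e.open_target (contDiffOn_gram g he _ _) _).add
    (contDiffOn_pderiv e.open_target (contDiffOn_gram g he _ _) _)).sub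
    (contDiffOn_pderiv e.open_target (contDiffOn_gram g he _ _) _)

/-- The Christoffel symbols of a chart, as a bilinear map. -/
def christoffelMap (g : Metric d M) (e : OpenPartialHomeomorph M (Model d)) (y : Model d) :
    Model d →L[ℝ] Model d →L[ℝ] Model d :=
  ∑ i, ∑ j, ∑ a, christoffel g e a i j y •
    (EuclideanSpace.proj (𝕜 := ℝ) i).smulRight
      ((EuclideanSpace.proj (𝕜 := ℝ) j).smulRight (EuclideanSpace.single a (1 : ℝ)))

theorem christoffelMap_single (g : Metric d M) (e : OpenPartialHomeomorph M (Model d))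
    (y : Model d) (i j : Fin d) :
    christoffelMap g e y (EuclideanSpace.single i 1) (EuclideanSpace.single j 1) =
      ∑ a, christoffel g e a i j y • EuclideanSpace.single a (1 : ℝ) := by
  simp only [christoffelMap, sum_apply, smul_apply,
    ContinuousLinearMap.smulRight_apply, EuclideanSpace.coe_proj, PiLp.single_apply]
  rw [Finset.sum_eq_single i, Finset.sum_eq_single j]
  · simp
  · intro b _ hb; simp [hb]
  · simp
  · intro b _ hb; simp [hb]
  · simp

theorem contDiffOn_christoffelMap (g : Metric d M) (he : e ∈ atlas (Model d) M) :
    ContDiffOn ℝ ∞ (christoffelMap g e) e.target :=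
  ContDiffOn.sum fun i _ => ContDiffOn.sum fun j _ => ContDiffOn.sum fun a _ =>
    (contDiffOn_christoffel g he a i j).smul contDiffOn_const

theorem hasFDerivAt_metricForm (g : Metric d M) (he : e ∈ atlas (Model d) M) {y : Model d}
    (hy : y ∈ e.target) :
    HasFDerivAt (metricForm g e) (fderiv ℝ (metricForm g e) y) y :=
  (((contDiffOn_metricForm g he).contDiffAt
    (e.open_target.mem_nhds hy)).differentiableAt (by simp)).hasFDerivAt

theorem pderiv_gram (g : Metric d M) (he : e ∈ atlas (Model d) M) {y : Model d}
    (hy : y ∈ e.target) (i j k : Fin d) : pderiv k (fun z => gram g e z i j) y =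
      fderiv ℝ (metricForm g e) y (EuclideanSpace.single k 1) (EuclideanSpace.single i 1)
        (EuclideanSpace.single j 1) := by
  have h := ((hasFDerivAt_metricForm g he hy).clm_apply
    (hasFDerivAt_const (EuclideanSpace.single i (1 : ℝ)) y)).clm_apply
    (hasFDerivAt_const (EuclideanSpace.single j (1 : ℝ)) y)
  have h' : (fun z => gram g e z i j) = fun z => metricForm g e z (EuclideanSpace.single i 1)
    (EuclideanSpace.single j 1) := rfl
  rw [pderiv, h', h.fderiv]
  simp

/-- The Koszul formula in a chart. -/
theorem metricForm_christoffelMap (g : Metric d M) (he : e ∈ atlas (Model d) M) {y : Model d}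
    (hy : y ∈ e.target) (v w u : Model d) :
    metricForm g e y u (christoffelMap g e y v w) = (1 / 2) *
      (fderiv ℝ (metricForm g e) y v u w + fderiv ℝ (metricForm g e) y w u v
        - fderiv ℝ (metricForm g e) y u v w) := by
  -- Both sides are linear in each of `u`, `v`, `w`, so basis vectors suffice; there the definition
  -- of `Γ` applies and the matrix `g_ij` cancels its inverse.
  induction u using model_induction with
  | h0 => simp
  | hadd a b ha hb => simp only [map_add, add_apply, ha, hb]; ring
  | hsmul c a ha => simp only [map_smul, smul_apply, ha, smul_eq_mul]; ring
  | hs m =>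
  induction v using model_induction with
  | h0 => simp
  | hadd a b ha hb => simp only [map_add, add_apply, ha, hb]; ring
  | hsmul c a ha => simp only [map_smul, smul_apply, ha, smul_eq_mul]; ring
  | hs i =>
  induction w using model_induction with
  | h0 => simp
  | hadd a b ha hb => simp only [map_add, add_apply, ha, hb]; ring
  | hsmul c a ha => simp only [map_smul, smul_apply, ha, smul_eq_mul]; ring
  | hs j =>
  have hdet : IsUnit (gram g e y).det := (gram_posDef g he hy).det_pos.ne'.isUnit
  have h1 := Matrix.mul_nonsing_inv _ hdet
  simp only [christoffelMap_single, map_sum, map_smul, smul_eq_mul, ← gram_apply,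
    ← pderiv_gram g he hy]
  set K : Fin d → ℝ := fun m => pderiv i (fun z => gram g e z m j) y
    + pderiv j (fun z => gram g e z m i) y - pderiv m (fun z => gram g e z i j) y with hK
  have h2 : ∀ a, christoffel g e a i j y = (1 / 2) * ((gram g e y)⁻¹.mulVec K) a := fun a => rfl
  have h3 : (gram g e y).mulVec ((gram g e y)⁻¹.mulVec K) = K := by
    rw [Matrix.mulVec_mulVec, h1, Matrix.one_mulVec]
  calc ∑ a, christoffel g e a i j y * gram g e y m a
      = (1 / 2) * (gram g e y).mulVec ((gram g e y)⁻¹.mulVec K) m := by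
        simp only [h2]
        rw [Matrix.mulVec, dotProduct, Finset.mul_sum]
        exact Finset.sum_congr rfl fun a _ => by ring
    _ = _ := by rw [h3]

/-- The metric determines the connection. Differentiating `metricForm_transition` relates the
derivatives of the two metric forms (`hD`). In the Koszul combination, symmetry of the second
derivative of `Ψ` leaves only `G(dΨ u, d²Ψ(v, w))`, which is the inhomogeneous term. -/
theorem fderiv_transition_christoffelMap (g : Metric d M) (he : e ∈ atlas (Model d) M)
    (he' : e' ∈ atlas (Model d) M) {y : Model d} (hy : y ∈ e'.target ∩ e'.symm ⁻¹' e.source)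
    (v w : Model d) :
    fderiv ℝ (fun y => e (e'.symm y)) y (christoffelMap g e' y v w) =
      fderiv ℝ (fderiv ℝ (fun y => e (e'.symm y))) y v w +
      christoffelMap g e (e (e'.symm y)) (fderiv ℝ (fun y => e (e'.symm y)) y v)
        (fderiv ℝ (fun y => e (e'.symm y)) y w) := by
  set Ψ : Model d → Model d := fun y => e (e'.symm y) with hΨ
  have hΨy : Ψ y ∈ e.target := e.map_source hy.2
  have hC : ContDiffOn ℝ ∞ Ψ _ := contDiffOn_transition he he'
  have hU := isOpen_transition e e'
  have hΨ1 : HasFDerivAt Ψ (fderiv ℝ Ψ y) y := hasFDerivAt_transition he he' hy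
  have hΨ2 : HasFDerivAt (fderiv ℝ Ψ) (fderiv ℝ (fderiv ℝ Ψ) y) y :=
    (((hC.fderiv_of_isOpen hU (m := ∞) (by simp)).contDiffAt
      (hU.mem_nhds hy)).differentiableAt (by simp)).hasFDerivAt
  have hG := (hasFDerivAt_metricForm g he hΨy).comp y hΨ1
  have hsymm : ∀ a b, fderiv ℝ (fderiv ℝ Ψ) y a b = fderiv ℝ (fderiv ℝ Ψ) y b a :=
    (hC.contDiffAt (hU.mem_nhds hy)).isSymmSndFDerivAt (by
      rw [minSmoothness_of_isRCLikeNormedField]; exact ENat.LEInfty.out)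
  have hD : ∀ a b c, fderiv ℝ (metricForm g e') y a b c =
      fderiv ℝ (metricForm g e) (Ψ y) (fderiv ℝ Ψ y a) (fderiv ℝ Ψ y b) (fderiv ℝ Ψ y c)
      + metricForm g e (Ψ y) (fderiv ℝ (fderiv ℝ Ψ) y a b) (fderiv ℝ Ψ y c)
      + metricForm g e (Ψ y) (fderiv ℝ Ψ y b) (fderiv ℝ (fderiv ℝ Ψ) y a c) := by
    intro a b c
    have h1 := ((hasFDerivAt_metricForm g he' hy.1).clm_apply
      (hasFDerivAt_const b y)).clm_apply (hasFDerivAt_const c y)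
    have h2 := (hG.clm_apply (hΨ2.clm_apply (hasFDerivAt_const b y))).clm_apply
      (hΨ2.clm_apply (hasFDerivAt_const c y))
    have h3 : (fun z => metricForm g e' z b c) =ᶠ[𝓝 y]
        fun z => (metricForm g e ∘ Ψ) z (fderiv ℝ Ψ z b) (fderiv ℝ Ψ z c) := by
      filter_upwards [hU.mem_nhds hy] with z hz using metricForm_transition g he he' hz b c
    have h4 := DFunLike.congr_fun (h1.unique (h2.congr_of_eventuallyEq h3)) a
    simp at h4
    rw [h4]
    ring
  -- Nondegeneracy reduces the vector identity to scalar ones, tested against vectors `dΨ u`.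
  have hpos : ∀ a : Model d, (∀ u, metricForm g e (Ψ y) u a = 0) → a = 0 := by
    intro a ha
    by_contra h
    exact (metricForm_pos g he hΨy h).ne' (ha a)
  rw [← sub_eq_zero]
  refine hpos _ fun u => ?_
  obtain ⟨u, rfl⟩ := fderiv_transition_surjective he he' hy u
  rw [map_sub, map_add]
  rw [← metricForm_transition g he he' hy, metricForm_christoffelMap g he' hy.1,
    metricForm_christoffelMap g he hΨy, hD, hD, hD, hsymm w v, hsymm v u, hsymm w u,
    metricForm_comm g e (Ψ y) (fderiv ℝ Ψ y v) (fderiv ℝ (fderiv ℝ Ψ) y u w)]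
  simp only [← hΨ]
  ring

end Christoffel

/-! ### Norms of tensors with respect to a positive definite matrix -/

section TensorNorm
variable {d k : ℕ}

/-- The squared norm of a covariant `k`-tensor with components `T` with respect to the matrix `A`
of a scalar product on covectors. -/
def tensorNormSq (A : Matrix (Fin d) (Fin d) ℝ) (T : (Fin k → Fin d) → ℝ) : ℝ :=
  ∑ i : Fin k → Fin d, ∑ j : Fin k → Fin d, (∏ l, A (i l) (j l)) * T i * T j

/-- The action of a matrix on the components of a `k`-tensor. -/
def tensorPush (B : Matrix (Fin d) (Fin d) ℝ) (T : (Fin k → Fin d) → ℝ) (m : Fin k → Fin d) : ℝ :=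
  ∑ i : Fin k → Fin d, (∏ l, B (m l) (i l)) * T i

/-- Multiplicativity of the `k`-th tensor power of matrices, by expanding a product of sums. -/
theorem prod_mul_apply (A B : Matrix (Fin d) (Fin d) ℝ) (i j : Fin k → Fin d) :
    ∏ l, (A * B) (i l) (j l) = ∑ m : Fin k → Fin d, (∏ l, A (i l) (m l)) * ∏ l, B (m l) (j l) := by
  simp only [Matrix.mul_apply, ← Finset.prod_mul_distrib]
  rw [Finset.prod_univ_sum, Fintype.piFinset_univ]

theorem tensorPush_mul (A B : Matrix (Fin d) (Fin d) ℝ) (T : (Fin k → Fin d) → ℝ) :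
    tensorPush (A * B) T = tensorPush A (tensorPush B T) := by
  ext m
  simp only [tensorPush, prod_mul_apply, Finset.sum_mul, Finset.mul_sum]
  rw [Finset.sum_comm]
  simp only [mul_assoc]

theorem prod_one_apply (i j : Fin k → Fin d) :
    ∏ l, (1 : Matrix (Fin d) (Fin d) ℝ) (i l) (j l) = if i = j then 1 else 0 := by
  simp only [Matrix.one_apply]
  rw [Finset.prod_ite_zero]
  simp [funext_iff]

theorem tensorPush_one (T : (Fin k → Fin d) → ℝ) : tensorPush 1 T = T := by
  ext m
  simp [tensorPush, prod_one_apply]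

theorem tensorNormSq_eq_sum_mul (A : Matrix (Fin d) (Fin d) ℝ) (T : (Fin k → Fin d) → ℝ) :
    tensorNormSq A T = ∑ i, T i * tensorPush A T i := by
  simp only [tensorNormSq, tensorPush, Finset.mul_sum]
  exact Finset.sum_congr rfl fun i _ => Finset.sum_congr rfl fun j _ => by ring

theorem sum_mul_tensorPush (A : Matrix (Fin d) (Fin d) ℝ) (S T : (Fin k → Fin d) → ℝ) :
    ∑ i, S i * tensorPush A T i = ∑ i, tensorPush A.transpose S i * T i := by
  simp only [tensorPush, Finset.mul_sum, Finset.sum_mul, Matrix.transpose_apply]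
  rw [Finset.sum_comm]
  exact Finset.sum_congr rfl fun i _ => Finset.sum_congr rfl fun j _ => by ring

theorem tensorNormSq_push (A B : Matrix (Fin d) (Fin d) ℝ) (T : (Fin k → Fin d) → ℝ) :
    tensorNormSq A (tensorPush B T) = tensorNormSq (B.transpose * A * B) T := by
  rw [tensorNormSq_eq_sum_mul, tensorNormSq_eq_sum_mul, mul_assoc, tensorPush_mul,
    tensorPush_mul, sum_mul_tensorPush B.transpose, Matrix.transpose_transpose]

theorem tensorNormSq_one (T : (Fin k → Fin d) → ℝ) : tensorNormSq 1 T = ∑ i, T i ^ 2 := by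
  simp only [tensorNormSq_eq_sum_mul, tensorPush_one, sq]

-- A nonnegative element of a C*-algebra has the form `star B * B`. Passing to `B`, an orthonormal
-- coframe, turns tensor norms into Euclidean norms.
open scoped MatrixOrder Matrix.Norms.L2Operator in
theorem exists_inv_eq_transpose_mul {G : Matrix (Fin d) (Fin d) ℝ} (hG : G.PosDef) :
    ∃ B : Matrix (Fin d) (Fin d) ℝ, IsUnit B.det ∧ G⁻¹ = B.transpose * B ∧
      G = B⁻¹ * B⁻¹.transpose := by
  obtain ⟨B, hB⟩ := CStarAlgebra.nonneg_iff_eq_star_mul_self.1 hG.inv.posSemidef.nonneg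
  have hB' : G⁻¹ = B.transpose * B := hB
  have hu : IsUnit B.det := by
    have h := hG.inv.det_pos
    rw [hB', Matrix.det_mul] at h
    exact (right_ne_zero_of_mul h.ne').isUnit
  refine ⟨B, hu, hB', ?_⟩
  have h : G = (G⁻¹)⁻¹ := (Matrix.nonsing_inv_nonsing_inv _ hG.det_pos.ne'.isUnit).symm
  rw [h, hB', Matrix.mul_inv_rev, Matrix.transpose_nonsing_inv]

/-- The norm of a `k`-tensor is a Euclidean norm. -/
theorem sqrt_tensorNormSq_eq_norm {A B : Matrix (Fin d) (Fin d) ℝ} (h : A = B.transpose * B)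
    (T : (Fin k → Fin d) → ℝ) :
    √(tensorNormSq A T) = ‖WithLp.toLp 2 (tensorPush B T)‖ := by
  rw [EuclideanSpace.norm_eq]
  congr 1
  rw [h, ← mul_one B.transpose, ← tensorNormSq_push, tensorNormSq_one]
  simp

theorem sqrt_tensorNormSq_inv_add_le {G : Matrix (Fin d) (Fin d) ℝ} (hG : G.PosDef)
    (S T : (Fin k → Fin d) → ℝ) :
    √(tensorNormSq G⁻¹ fun i => S i + T i) ≤ √(tensorNormSq G⁻¹ S) + √(tensorNormSq G⁻¹ T) := by
  obtain ⟨B, -, hB, -⟩ := exists_inv_eq_transpose_mul hG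
  simp only [sqrt_tensorNormSq_eq_norm hB]
  refine le_trans (le_of_eq ?_) (norm_add_le _ _)
  congr 1
  ext m
  simp [tensorPush, mul_add, Finset.sum_add_distrib]

theorem sqrt_tensorNormSq_smul (A : Matrix (Fin d) (Fin d) ℝ) (c : ℝ) (T : (Fin k → Fin d) → ℝ) :
    √(tensorNormSq A fun i => c * T i) = |c| * √(tensorNormSq A T) := by
  rw [← Real.sqrt_sq_eq_abs, ← Real.sqrt_mul (sq_nonneg c)]
  congr 1
  simp only [tensorNormSq, Finset.mul_sum]
  exact Finset.sum_congr rfl fun i _ => Finset.sum_congr rfl fun j _ => by ring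

/-- Cauchy–Schwarz for `T = (B⁻¹)^{⊗k} (B^{⊗k} T)`: row `i` of `(B⁻¹)^{⊗k}` has squared length `∏ G
(i l) (i l)` because `G = B⁻¹ B⁻ᵀ`. -/
theorem abs_le_sqrt_tensorNormSq_inv {G : Matrix (Fin d) (Fin d) ℝ} (hG : G.PosDef)
    (T : (Fin k → Fin d) → ℝ) (i : Fin k → Fin d) :
    |T i| ≤ √(∏ l, G (i l) (i l)) * √(tensorNormSq G⁻¹ T) := by
  obtain ⟨B, hu, hB, hB'⟩ := exists_inv_eq_transpose_mul hG
  have h1 : T i = ∑ m : Fin k → Fin d, (∏ l, B⁻¹ (i l) (m l)) * tensorPush B T m := by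
    conv_lhs => rw [← tensorPush_one T, ← Matrix.nonsing_inv_mul B hu, tensorPush_mul]
    rfl
  have h2 : ∏ l, G (i l) (i l) = ∑ m : Fin k → Fin d, (∏ l, B⁻¹ (i l) (m l)) ^ 2 := by
    rw [hB', prod_mul_apply]
    simp only [Matrix.transpose_apply, sq]
  have h3 : tensorNormSq G⁻¹ T = ∑ m : Fin k → Fin d, tensorPush B T m ^ 2 := by
    rw [hB, ← mul_one B.transpose, ← tensorNormSq_push, tensorNormSq_one]
  rw [h2, h3, h1]
  exact (Real.abs_le_sqrt (Finset.sum_mul_sq_le_sq_mul_sq _ _ _)).trans_eq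
    (Real.sqrt_mul (Finset.sum_nonneg fun _ _ => sq_nonneg _) _)

end TensorNorm

/-! ### Components of `∇^k f` and chart independence of their norm -/

section CovDeriv
variable {d : ℕ} {M : Type*} [TopologicalSpace M] [ChartedSpace (Model d) M]
  [IsManifold (𝓡 d) ∞ M]
variable {e e' : OpenPartialHomeomorph M (Model d)}

theorem contDiffOn_chart_covTensor (g : Metric d M) (he : e ∈ atlas (Model d) M)
    (f : C^∞⟮𝓡 d, M; ℝ⟯) (k : ℕ) :
    ContDiffOn ℝ ∞ (covTensor (christoffelMap g e) (fun y => f (e.symm y)) k) e.target :=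
  contDiffOn_covTensor e.open_target (contDiffOn_christoffelMap g he) (contDiffOn_comp_symm he f) k

theorem pderiv_congr {F F' : Model d → ℝ} {U : Set (Model d)} (hU : IsOpen U) (h : EqOn F F' U)
    (i : Fin d) : EqOn (pderiv i F) (pderiv i F') U := by
  intro y hy
  have : F =ᶠ[𝓝 y] F' := by filter_upwards [hU.mem_nhds hy] with z hz using h hz
  rw [pderiv, pderiv, this.fderiv_eq]

/-- Evaluation at a fixed tuple of basis vectors is a continuous linear map, so it commutes with
differentiation, and the two recursions match. This makes the naturality of `covTensor` available
for components. -/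
theorem covDeriv_eq_covTensor (g : Metric d M) (he : e ∈ atlas (Model d) M)
    (f : C^∞⟮𝓡 d, M; ℝ⟯) (k : ℕ) (i : Fin k → Fin d) :
    EqOn (covDeriv g e f k i) (fun y => covTensor (christoffelMap g e) (fun y => f (e.symm y)) k y
      fun l => EuclideanSpace.single (i l) 1) e.target := by
  induction k with
  | zero => intro y _; rfl
  | succ k ih =>
    intro y hy
    have hT := (((contDiffOn_chart_covTensor g he f k).contDiffAt
        (e.open_target.mem_nhds hy)).differentiableAt (by simp)).hasFDerivAt
    have h1 := pderiv_congr e.open_target (ih (Fin.tail i)) (i 0) hy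
    have h2 := (ContinuousMultilinearMap.apply ℝ (fun _ : Fin k => Model d) ℝ
      (fun l => EuclideanSpace.single (Fin.tail i l) (1 : ℝ))).hasFDerivAt.comp y hT
    have h3 : pderiv (i 0) (fun y => covTensor (christoffelMap g e) (fun y => f (e.symm y)) k y
        fun l => EuclideanSpace.single (Fin.tail i l) 1) y =
        fderiv ℝ (covTensor (christoffelMap g e) (fun y => f (e.symm y)) k) y
          (EuclideanSpace.single (i 0) 1) (fun l => EuclideanSpace.single (Fin.tail i l) 1) := by
      rw [pderiv]
      exact DFunLike.congr_fun h2.fderiv _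
    show _ = covTensor (christoffelMap g e) (fun y => f (e.symm y)) (k + 1) y
      (fun l => EuclideanSpace.single (i l) 1)
    rw [covDeriv, covTensor_succ_apply, h1, h3]
    refine congr_arg₂ (· - ·) rfl (Finset.sum_congr rfl fun l _ => ?_)
    have h4 : ∀ a, covDeriv g e f k (Function.update (Fin.tail i) l a) y =
        covTensor (christoffelMap g e) (fun y => f (e.symm y)) k y
          (Function.update (fun l => EuclideanSpace.single (Fin.tail i l) 1) l
            (EuclideanSpace.single a 1)) := by
      intro a
      rw [ih _ hy]
      refine congr_arg _ (funext fun m => ?_)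
      by_cases h : m = l
      · subst h; simp
      · simp [h]
    have h5 : (Fin.tail fun l => EuclideanSpace.single (i l) (1 : ℝ)) =
      fun l => EuclideanSpace.single (Fin.tail i l) (1 : ℝ) := rfl
    simp only [h5, christoffelMap_single, h4]
    exact (((covTensor (christoffelMap g e) (fun y => f (e.symm y)) k y).toMultilinearMap.map_update_sum
      Finset.univ l _ _).trans (Finset.sum_congr rfl fun a _ =>
        ContinuousMultilinearMap.map_update_smul _ _ _ _ _)).symm

theorem contDiffOn_covDeriv (g : Metric d M) (he : e ∈ atlas (Model d) M)
    (f : C^∞⟮𝓡 d, M; ℝ⟯) (k : ℕ) (i : Fin k → Fin d) :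
    ContDiffOn ℝ ∞ (covDeriv g e f k i) e.target :=
  ((ContinuousMultilinearMap.apply ℝ (fun _ : Fin k => Model d) ℝ
      (fun l => EuclideanSpace.single (i l) (1 : ℝ))).contDiff.comp_contDiffOn
    (contDiffOn_chart_covTensor g he f k)).congr (covDeriv_eq_covTensor g he f k i)

/-- The Jacobian matrix of the transition map from `e'` to `e`. -/
def jacobian (e e' : OpenPartialHomeomorph M (Model d)) (y : Model d) :
    Matrix (Fin d) (Fin d) ℝ :=
  Matrix.of fun a i => fderiv ℝ (fun y => e (e'.symm y)) y (EuclideanSpace.single i 1) a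

theorem fderiv_transition_single (e e' : OpenPartialHomeomorph M (Model d)) (y : Model d)
    (i : Fin d) : fderiv ℝ (fun y => e (e'.symm y)) y (EuclideanSpace.single i 1) =
      ∑ a, jacobian e e' y a i • EuclideanSpace.single a (1 : ℝ) :=
  model_eq_sum _

theorem gram_transition (g : Metric d M) (he : e ∈ atlas (Model d) M)
    (he' : e' ∈ atlas (Model d) M) {y : Model d} (hy : y ∈ e'.target ∩ e'.symm ⁻¹' e.source) :
    gram g e' y =
      (jacobian e e' y).transpose * gram g e (e (e'.symm y)) * jacobian e e' y := by
  ext i j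
  rw [gram_apply, metricForm_transition g he he' hy, fderiv_transition_single,
    fderiv_transition_single]
  simp only [map_sum, map_smul, sum_apply, smul_apply, smul_eq_mul, ← gram_apply,
    Matrix.mul_apply, Matrix.transpose_apply, Finset.sum_mul, Finset.mul_sum]
  exact Finset.sum_congr rfl fun a _ => Finset.sum_congr rfl fun b _ => by ring

theorem covDeriv_transition (g : Metric d M) (he : e ∈ atlas (Model d) M)
    (he' : e' ∈ atlas (Model d) M) {y : Model d} (hy : y ∈ e'.target ∩ e'.symm ⁻¹' e.source)
    (f : C^∞⟮𝓡 d, M; ℝ⟯) (k : ℕ) :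
    (fun i => covDeriv g e' f k i y) = tensorPush (jacobian e e' y).transpose
      fun i => covDeriv g e f k i (e (e'.symm y)) := by
  ext i
  have h := covTensor_comp (k := k) e.open_target (contDiffOn_christoffelMap g he)
    (contDiffOn_comp_symm he f) (isOpen_transition e e') (contDiffOn_transition he he')
    (fun z hz => e.map_source hz.2) (F' := fun y => f (e'.symm y))
    (fun z hz => congr_arg f (e.left_inv hz.2).symm)
    (fun z hz => fderiv_transition_christoffelMap g he he' hz) hy
  rw [covDeriv_eq_covTensor g he' f k i hy.1]
  simp only [h, ContinuousMultilinearMap.compContinuousLinearMap_apply, fderiv_transition_single]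
  rw [ContinuousMultilinearMap.map_sum, tensorPush]
  refine Finset.sum_congr rfl fun a _ => ?_
  rw [covDeriv_eq_covTensor g he f k a (e.map_source hy.2)]
  exact ContinuousMultilinearMap.map_smul_univ _ _ _

theorem isUnit_det_jacobian (g : Metric d M) (he : e ∈ atlas (Model d) M)
    (he' : e' ∈ atlas (Model d) M) {y : Model d} (hy : y ∈ e'.target ∩ e'.symm ⁻¹' e.source) :
    IsUnit (jacobian e e' y).det := by
  have h := (gram_posDef g he' hy.1).det_pos
  rw [gram_transition g he he' hy, Matrix.det_mul] at h
  exact (right_ne_zero_of_mul h.ne').isUnit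

/-- The norm of `∇^k f` can be computed in any chart. -/
theorem covDerivNorm_eq (g : Metric d M) (he : e ∈ atlas (Model d) M) {x : M} (hx : x ∈ e.source)
    (f : C^∞⟮𝓡 d, M; ℝ⟯) (k : ℕ) :
    covDerivNorm g k f x =
      √(tensorNormSq (gram g e (e x))⁻¹ fun i => covDeriv g e f k i (e x)) := by
  set e' := chartAt (Model d) x with he'
  have he'a : e' ∈ atlas (Model d) M := chart_mem_atlas _ _
  have hx' : x ∈ e'.source := mem_chart_source _ _
  have hy : e' x ∈ e'.target ∩ e'.symm ⁻¹' e.source :=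
    ⟨e'.map_source hx', by simpa [e'.left_inv hx'] using hx⟩
  have h1 := covDeriv_transition g he he'a hy f k
  have h2 := gram_transition g he he'a hy
  have hJ := isUnit_det_jacobian g he he'a hy
  rw [e'.left_inv hx'] at h1 h2
  have h3 : covDerivNorm g k f x =
      √(tensorNormSq (gram g e' (e' x))⁻¹ fun i => covDeriv g e' f k i (e' x)) := rfl
  -- The components change by `Jᵀ` in each slot and the inverse metric becomes `J⁻¹ G⁻¹ J⁻ᵀ`, so all
  -- Jacobians cancel.
  rw [h3, h1, tensorNormSq_push, h2, Matrix.mul_inv_rev, Matrix.mul_inv_rev,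
    Matrix.transpose_transpose]
  congr 2
  rw [Matrix.mul_nonsing_inv_cancel_left _ _ hJ, mul_assoc, Matrix.nonsing_inv_mul, mul_one]
  rwa [Matrix.det_transpose]

end CovDeriv

/-! ### Continuity, seminorm properties and locality of `|∇^k f|` -/

section CovDerivNorm
variable {d : ℕ} {M : Type*} [TopologicalSpace M] [ChartedSpace (Model d) M]
  [IsManifold (𝓡 d) ∞ M]
variable {e : OpenPartialHomeomorph M (Model d)}

theorem covDerivNorm_nonneg (g : Metric d M) (k : ℕ) (f : M → ℝ) (x : M) :
    0 ≤ covDerivNorm g k f x := Real.sqrt_nonneg _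

/-- The definition uses a chart that may jump from point to point; chart independence allows one
fixed chart near `x`, where the formula is continuous. -/
theorem continuous_covDerivNorm (g : Metric d M) (k : ℕ) (f : C^∞⟮𝓡 d, M; ℝ⟯) :
    Continuous (covDerivNorm g k f) := by
  rw [continuous_iff_continuousAt]
  intro x
  set e := chartAt (Model d) x with he
  have hea : e ∈ atlas (Model d) M := chart_mem_atlas _ _
  have hx : x ∈ e.source := mem_chart_source _ _
  have h : covDerivNorm g k f =ᶠ[𝓝 x] fun z =>
      √(tensorNormSq (gram g e (e z))⁻¹ fun i => covDeriv g e f k i (e z)) := by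
    filter_upwards [e.open_source.mem_nhds hx] with z hz using covDerivNorm_eq g hea hz f k
  refine ContinuousAt.congr ?_ h.symm
  have hc : ∀ {F : Model d → ℝ}, ContDiffOn ℝ ∞ F e.target → ContinuousAt (fun z => F (e z)) x :=
    fun {F} hF => ContinuousAt.comp (f := e) (g := F) (hF.continuousOn.continuousAt
      (e.open_target.mem_nhds (e.map_source hx))) (e.continuousAt hx)
  refine ContinuousAt.sqrt ?_
  simp only [tensorNormSq]
  refine tendsto_finsetSum _ fun i _ => tendsto_finsetSum _ fun j _ => ?_
  exact ((tendsto_finsetProd _ fun l _ => hc (contDiffOn_gram_inv g hea _ _)).mul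
    (hc (contDiffOn_covDeriv g hea f k i))).mul (hc (contDiffOn_covDeriv g hea f k j))

theorem hasFDerivAt_covDeriv (g : Metric d M) (he : e ∈ atlas (Model d) M)
    (f : C^∞⟮𝓡 d, M; ℝ⟯) (k : ℕ) (i : Fin k → Fin d) {y : Model d} (hy : y ∈ e.target) :
    HasFDerivAt (covDeriv g e f k i) (fderiv ℝ (covDeriv g e f k i) y) y :=
  (((contDiffOn_covDeriv g he f k i).contDiffAt
    (e.open_target.mem_nhds hy)).differentiableAt (by simp)).hasFDerivAt

theorem covDeriv_add (g : Metric d M) (he : e ∈ atlas (Model d) M)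
    (u v : C^∞⟮𝓡 d, M; ℝ⟯) (k : ℕ) (i : Fin k → Fin d) :
    EqOn (covDeriv g e (u + v : C^∞⟮𝓡 d, M; ℝ⟯) k i)
      (fun y => covDeriv g e u k i y + covDeriv g e v k i y) e.target := by
  induction k with
  | zero => intro y _; rfl
  | succ k ih =>
    intro y hy
    have h := ((hasFDerivAt_covDeriv g he u k (Fin.tail i) hy).fun_add
      (hasFDerivAt_covDeriv g he v k (Fin.tail i) hy)).fderiv
    simp only [covDeriv]
    rw [pderiv_congr e.open_target (ih _) (i 0) hy, pderiv, pderiv, pderiv,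
      DFunLike.congr_fun h, add_apply]
    simp only [ih _ hy, mul_add, Finset.sum_add_distrib]
    ring

theorem covDeriv_smul (g : Metric d M) (he : e ∈ atlas (Model d) M) (c : ℝ)
    (u : C^∞⟮𝓡 d, M; ℝ⟯) (k : ℕ) (i : Fin k → Fin d) :
    EqOn (covDeriv g e (c • u : C^∞⟮𝓡 d, M; ℝ⟯) k i)
      (fun y => c * covDeriv g e u k i y) e.target := by
  induction k with
  | zero => intro y _; rfl
  | succ k ih =>
    intro y hy
    have h := ((hasFDerivAt_covDeriv g he u k (Fin.tail i) hy).const_mul c).fderiv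
    simp only [covDeriv]
    rw [pderiv_congr e.open_target (ih _) (i 0) hy, pderiv, pderiv,
      DFunLike.congr_fun h, smul_apply, smul_eq_mul]
    simp only [ih _ hy, mul_sub, Finset.mul_sum]
    congr 1
    exact Finset.sum_congr rfl fun l _ => Finset.sum_congr rfl fun a _ => by ring

theorem covDerivNorm_add_le (g : Metric d M) (k : ℕ) (u v : C^∞⟮𝓡 d, M; ℝ⟯) (x : M) :
    covDerivNorm g k (u + v : C^∞⟮𝓡 d, M; ℝ⟯) x ≤ covDerivNorm g k u x + covDerivNorm g k v x := by
  have hea : chartAt (Model d) x ∈ atlas (Model d) M := chart_mem_atlas _ _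
  have hx : x ∈ (chartAt (Model d) x).source := mem_chart_source _ _
  have hy := (chartAt (Model d) x).map_source hx
  simp only [covDerivNorm_eq g hea hx, covDeriv_add g hea u v k _ hy]
  exact sqrt_tensorNormSq_inv_add_le (gram_posDef g hea hy) _ _

theorem covDerivNorm_smul (g : Metric d M) (k : ℕ) (c : ℝ) (u : C^∞⟮𝓡 d, M; ℝ⟯) (x : M) :
    covDerivNorm g k (c • u : C^∞⟮𝓡 d, M; ℝ⟯) x = |c| * covDerivNorm g k u x := by
  have hea : chartAt (Model d) x ∈ atlas (Model d) M := chart_mem_atlas _ _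
  have hx : x ∈ (chartAt (Model d) x).source := mem_chart_source _ _
  have hy := (chartAt (Model d) x).map_source hx
  simp only [covDerivNorm_eq g hea hx, covDeriv_smul g hea c u k _ hy]
  exact sqrt_tensorNormSq_smul _ _ _

theorem covDerivNorm_zero (g : Metric d M) (u : M → ℝ) (x : M) :
    covDerivNorm g 0 u x = |u x| := by
  have h : (chartAt (Model d) x).symm (chartAt (Model d) x x) = x :=
    (chartAt (Model d) x).left_inv (mem_chart_source _ _)
  simp only [covDerivNorm, covDeriv, Finset.univ_unique, Finset.sum_singleton,
    Finset.univ_eq_empty, Finset.prod_empty, one_mul, h]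
  exact Real.sqrt_mul_self_eq_abs _

theorem covDeriv_congr (g : Metric d M) {f h : M → ℝ} {y : Model d}
    (hfh : (fun z => f (e.symm z)) =ᶠ[𝓝 y] fun z => h (e.symm z)) (k : ℕ) (i : Fin k → Fin d) :
    covDeriv g e f k i =ᶠ[𝓝 y] covDeriv g e h k i := by
  induction k with
  | zero => exact hfh
  | succ k ih =>
    have h1 : ∀ᶠ z in 𝓝 y, ∀ i, covDeriv g e f k i z = covDeriv g e h k i z :=
      eventually_all.2 ih
    filter_upwards [(ih (Fin.tail i)).fderiv (𝕜 := ℝ), h1] with z hz1 hz2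
    simp only [covDeriv, pderiv, hz1, hz2]

theorem covDeriv_zero_fun (g : Metric d M) (e : OpenPartialHomeomorph M (Model d)) (k : ℕ)
    (i : Fin k → Fin d) : covDeriv g e (fun _ => 0) k i = fun _ => 0 := by
  induction k with
  | zero => rfl
  | succ k ih => ext y; simp [covDeriv, pderiv, ih]

theorem covDerivNorm_eq_zero (g : Metric d M) (k : ℕ) {f : M → ℝ} {x : M}
    (hf : f =ᶠ[𝓝 x] fun _ => 0) : covDerivNorm g k f x = 0 := by
  have hx : x ∈ (chartAt (Model d) x).source := mem_chart_source _ _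
  have h1 : Tendsto (chartAt (Model d) x).symm (𝓝 (chartAt (Model d) x x)) (𝓝 x) := by
    simpa using (chartAt (Model d) x).tendsto_symm hx
  have h2 : (fun z => f ((chartAt (Model d) x).symm z)) =ᶠ[𝓝 (chartAt (Model d) x x)]
      fun _ => 0 := h1.eventually hf
  have h3 : ∀ i, covDeriv g (chartAt (Model d) x) f k i (chartAt (Model d) x x) = 0 := fun i =>
    ((covDeriv_congr g (h := fun _ => 0) h2 k i).eq_of_nhds).trans (by rw [covDeriv_zero_fun])
  simp [covDerivNorm, h3]

theorem support_covDerivNorm_subset (g : Metric d M) (k : ℕ) (f : M → ℝ) :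
    Function.support (covDerivNorm g k f) ⊆ tsupport f := by
  intro x hx
  by_contra h
  exact hx (covDerivNorm_eq_zero g k (notMem_tsupport_iff_eventuallyEq.1 h))

end CovDerivNorm

/-! ### Leibniz bound for multiplication by a test function -/

section Leibniz
variable {d : ℕ} {M : Type*} [TopologicalSpace M] [ChartedSpace (Model d) M]
  [IsManifold (𝓡 d) ∞ M]
variable {e : OpenPartialHomeomorph M (Model d)}

/-- The operators on smooth functions which, in a chart, are linear combinations of the components
of the covariant derivatives up to order `n`, with smooth coefficients. -/
inductive IsCovComb (g : Metric d M) (e : OpenPartialHomeomorph M (Model d)) :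
    ℕ → (C^∞⟮𝓡 d, M; ℝ⟯ → Model d → ℝ) → Prop
  | covDeriv {n k : ℕ} (hk : k ≤ n) (i : Fin k → Fin d) :
      IsCovComb g e n (fun u => covDeriv g e u k i)
  | zero {n : ℕ} : IsCovComb g e n (fun _ _ => 0)
  | add {n : ℕ} {S T : C^∞⟮𝓡 d, M; ℝ⟯ → Model d → ℝ} (hS : IsCovComb g e n S)
      (hT : IsCovComb g e n T) : IsCovComb g e n (fun u y => S u y + T u y)
  | mul {n : ℕ} {b : Model d → ℝ} {T : C^∞⟮𝓡 d, M; ℝ⟯ → Model d → ℝ}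
      (hb : ContDiffOn ℝ ∞ b e.target) (hT : IsCovComb g e n T) :
      IsCovComb g e n (fun u y => b y * T u y)
  | congr {n : ℕ} {S T : C^∞⟮𝓡 d, M; ℝ⟯ → Model d → ℝ} (hS : IsCovComb g e n S)
      (h : ∀ u, EqOn (T u) (S u) e.target) : IsCovComb g e n T

namespace IsCovComb
variable {g : Metric d M} {n m : ℕ} {S T : C^∞⟮𝓡 d, M; ℝ⟯ → Model d → ℝ}

theorem mono (hT : IsCovComb g e n T) (h : n ≤ m) : IsCovComb g e m T := by
  induction hT with
  | covDeriv hk i => exact .covDeriv (hk.trans h) i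
  | zero => exact .zero
  | add _ _ h1 h2 => exact .add h1 h2
  | mul hb _ h1 => exact .mul hb h1
  | congr _ hST h1 => exact .congr h1 hST

theorem sum {ι : Type*} (s : Finset ι) {T : ι → C^∞⟮𝓡 d, M; ℝ⟯ → Model d → ℝ}
    (hT : ∀ a ∈ s, IsCovComb g e n (T a)) : IsCovComb g e n (fun u y => ∑ a ∈ s, T a u y) := by
  classical
  induction s using Finset.induction_on with
  | empty => simpa using IsCovComb.zero
  | insert a s ha ih =>
    simp only [Finset.sum_insert ha]
    exact .add (hT a (by simp)) (ih fun b hb => hT b (by simp [hb]))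

theorem neg (hT : IsCovComb g e n T) : IsCovComb g e n (fun u y => - T u y) := by
  simpa using IsCovComb.mul (b := fun _ => -1) contDiffOn_const hT

theorem contDiffOn (he : e ∈ atlas (Model d) M) (hT : IsCovComb g e n T)
    (u : C^∞⟮𝓡 d, M; ℝ⟯) : ContDiffOn ℝ ∞ (T u) e.target := by
  induction hT with
  | covDeriv hk i => exact contDiffOn_covDeriv g he u _ i
  | zero => exact contDiffOn_const
  | add _ _ h1 h2 => exact h1.add h2
  | mul hb _ h1 => exact hb.mul h1
  | congr _ hST h1 => exact h1.congr (hST u)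

theorem pderiv (he : e ∈ atlas (Model d) M) (hT : IsCovComb g e n T) (j : Fin d) :
    IsCovComb g e (n + 1) (fun u => pderiv j (T u)) := by
  have hdiff : ∀ {F : Model d → ℝ} {y}, ContDiffOn ℝ ∞ F e.target → y ∈ e.target →
      DifferentiableAt ℝ F y := fun hF hy =>
    (hF.contDiffAt (e.open_target.mem_nhds hy)).differentiableAt (by simp)
  induction hT with
  | @covDeriv k hk i =>
    -- The recursion for `∇^{k+1}`, solved for the partial derivative.
    have h1 : IsCovComb g e (n + 1) (fun u y =>
        LocSob.covDeriv g e u (k + 1) (Fin.cons j i : Fin (k + 1) → Fin d) y +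
        ∑ l : Fin k, ∑ a : Fin d, christoffel g e a j (i l) y *
          LocSob.covDeriv g e u k (Function.update i l a) y) :=
      .add (.covDeriv (by omega) _) (.sum _ fun l _ => .sum _ fun a _ =>
        .mul (contDiffOn_christoffel g he a j (i l)) (.covDeriv (by omega) _))
    refine h1.congr fun u y _ => ?_
    simp [LocSob.covDeriv]
  | zero => exact IsCovComb.zero.congr fun u y _ => by simp [LocSob.pderiv]
  | add hS hT h1 h2 =>
    refine (h1.add h2).congr fun u y hy => ?_
    exact DFunLike.congr_fun (fderiv_fun_add (hdiff (hS.contDiffOn he u) hy)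
      (hdiff (hT.contDiffOn he u) hy)) _
  | @mul b T hb hT h1 =>
    have h2 : IsCovComb g e (n + 1) (fun u y => b y * LocSob.pderiv j (T u) y +
        LocSob.pderiv j b y * T u y) :=
      .add (h1.mul hb) (.mul (contDiffOn_pderiv e.open_target hb j) (hT.mono (by omega)))
    refine h2.congr fun u y hy => ?_
    have := DFunLike.congr_fun (fderiv_fun_mul (hdiff hb hy) (hdiff (hT.contDiffOn he u) hy))
      (EuclideanSpace.single j 1)
    refine this.trans ?_
    simp [LocSob.pderiv, mul_comm]
  | congr _ hST h1 => exact h1.congr fun u => pderiv_congr e.open_target (hST u) j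

/-- The coefficients are continuous on `K` and do not depend on `u`, hence neither does `C`. -/
theorem exists_bound (hT : IsCovComb g e n T) {K : Set (Model d)} (hK : IsCompact K)
    (hKe : K ⊆ e.target) : ∃ C : ℝ, 0 ≤ C ∧ ∀ u, ∀ y ∈ K, |T u y| ≤
      C * ∑ k ∈ Finset.range (n + 1), ∑ i : Fin k → Fin d, |LocSob.covDeriv g e u k i y| := by
  induction hT with
  | @covDeriv k hk i =>
    refine ⟨1, zero_le_one, fun u y _ => ?_⟩
    rw [one_mul]
    refine le_trans ?_ (Finset.single_le_sum
      (f := fun k => ∑ i : Fin k → Fin d, |LocSob.covDeriv g e u k i y|)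
      (fun _ _ => Finset.sum_nonneg fun _ _ => abs_nonneg _)
      (Finset.mem_range.2 (Nat.lt_succ_of_le hk)))
    exact Finset.single_le_sum (f := fun i => |LocSob.covDeriv g e u k i y|)
      (fun _ _ => abs_nonneg _) (Finset.mem_univ i)
  | zero => exact ⟨0, le_rfl, fun u y _ => by simp⟩
  | add _ _ h1 h2 =>
    obtain ⟨C, hC, h1⟩ := h1
    obtain ⟨D, hD, h2⟩ := h2
    refine ⟨C + D, add_nonneg hC hD, fun u y hy => ?_⟩
    rw [add_mul]
    exact (abs_add_le _ _).trans (add_le_add (h1 u y hy) (h2 u y hy))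
  | mul hb _ h1 =>
    obtain ⟨C, hC, h1⟩ := h1
    obtain ⟨D, hD⟩ := hK.exists_bound_of_continuousOn (hb.continuousOn.mono hKe)
    refine ⟨|D| * C, mul_nonneg (abs_nonneg _) hC, fun u y hy => ?_⟩
    rw [abs_mul, mul_assoc]
    exact mul_le_mul ((hD y hy).trans (le_abs_self D)) (h1 u y hy) (abs_nonneg _) (abs_nonneg _)
  | congr _ hST h1 =>
    obtain ⟨C, hC, h1⟩ := h1
    exact ⟨C, hC, fun u y hy => by rw [hST u (hKe hy)]; exact h1 u y hy⟩

end IsCovComb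

/-- The class is closed under smooth coefficients and, with the order raised by one, under `∂_j`; so
the recursion for `∇^k` stays in it and no explicit Leibniz formula is needed. -/
theorem isCovComb_mul (g : Metric d M) (he : e ∈ atlas (Model d) M) (η : C^∞⟮𝓡 d, M; ℝ⟯)
    (k : ℕ) (i : Fin k → Fin d) :
    IsCovComb g e k (fun u => covDeriv g e (η * u : C^∞⟮𝓡 d, M; ℝ⟯) k i) := by
  induction k with
  | zero => exact .mul (contDiffOn_comp_symm he η) (.covDeriv le_rfl i)
  | succ k ih =>
    have h : IsCovComb g e (k + 1) (fun u y =>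
        pderiv (i 0) (covDeriv g e (η * u : C^∞⟮𝓡 d, M; ℝ⟯) k (Fin.tail i)) y +
        -∑ l : Fin k, ∑ a : Fin d, christoffel g e a (i 0) (Fin.tail i l) y *
          covDeriv g e (η * u : C^∞⟮𝓡 d, M; ℝ⟯) k (Function.update (Fin.tail i) l a) y) :=
      .add ((ih _).pderiv he _) (.neg (.sum _ fun l _ => .sum _ fun a _ =>
        .mul (contDiffOn_christoffel g he _ _ _) ((ih _).mono (by omega))))
    exact h.congr fun u y _ => by simp [covDeriv, sub_eq_add_neg]

/-- A local bound of `|∇^k (η u)|`. -/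
theorem exists_covDerivNorm_mul_le_of_chart (g : Metric d M) (he : e ∈ atlas (Model d) M)
    (η : C^∞⟮𝓡 d, M; ℝ⟯) (k : ℕ) {K : Set M} (hK : IsCompact K) (hKe : K ⊆ e.source) :
    ∃ C : ℝ, 0 ≤ C ∧ ∀ u : C^∞⟮𝓡 d, M; ℝ⟯, ∀ x ∈ K,
      covDerivNorm g k (η * u : C^∞⟮𝓡 d, M; ℝ⟯) x ≤
        C * ∑ j ∈ Finset.range (k + 1), covDerivNorm g j u x := by
  have hK' : IsCompact (e '' K) := hK.image_of_continuousOn (e.continuousOn.mono hKe)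
  have hKt : e '' K ⊆ e.target := by rintro _ ⟨x, hx, rfl⟩; exact e.map_source (hKe hx)
  choose C hC hC' using fun i : Fin k → Fin d => (isCovComb_mul g he η k i).exists_bound hK' hKt
  choose A hA using fun (i j : Fin k → Fin d) => hK'.exists_bound_of_continuousOn
    (f := fun y => ∏ l, (gram g e y)⁻¹ (i l) (j l)) (continuousOn_finsetProd _ fun l _ =>
      (contDiffOn_gram_inv g he (i l) (j l)).continuousOn.mono hKt)
  choose B hB using fun (j : ℕ) (i : Fin j → Fin d) => hK'.exists_bound_of_continuousOn
    (f := fun y => √(∏ l, gram g e y (i l) (i l))) (ContinuousOn.sqrt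
      (continuousOn_finsetProd _ fun l _ =>
        (contDiffOn_gram g he (i l) (i l)).continuousOn.mono hKt))
  -- With `s` the sum of all `|∇^j u|` components of order at most `k`, one gets `|∇^k(η u)|² ≤ R
  -- s²`; `Q` then bounds `s` by the invariant norms of `∇^j u`.
  set R : ℝ := ∑ i, ∑ j, |A i j| * C i * C j with hR
  set Q : ℝ := ∑ j ∈ Finset.range (k + 1), ∑ i : Fin j → Fin d, |B j i| with hQ
  have hQ0 : 0 ≤ Q := Finset.sum_nonneg fun _ _ => Finset.sum_nonneg fun _ _ => abs_nonneg _
  have hR0 : 0 ≤ R := Finset.sum_nonneg fun _ _ => Finset.sum_nonneg fun _ _ =>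
    mul_nonneg (mul_nonneg (abs_nonneg _) (hC _)) (hC _)
  refine ⟨√R * Q, by positivity, fun u x hx => ?_⟩
  have hy : e x ∈ e '' K := mem_image_of_mem _ hx
  set s : ℝ := ∑ j ∈ Finset.range (k + 1), ∑ i : Fin j → Fin d, |covDeriv g e u j i (e x)| with hs
  have hs0 : 0 ≤ s := Finset.sum_nonneg fun _ _ => Finset.sum_nonneg fun _ _ => abs_nonneg _
  have h1 : covDerivNorm g k (η * u : C^∞⟮𝓡 d, M; ℝ⟯) x ≤ √R * s := by
    rw [covDerivNorm_eq g he (hKe hx), ← Real.sqrt_sq hs0, ← Real.sqrt_mul hR0]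
    refine Real.sqrt_le_sqrt ?_
    rw [tensorNormSq, hR, Finset.sum_mul]
    refine Finset.sum_le_sum fun i _ => ?_
    rw [Finset.sum_mul]
    refine Finset.sum_le_sum fun j _ => (le_abs_self _).trans ?_
    rw [abs_mul, abs_mul]
    have h2 : |∏ l, (gram g e (e x))⁻¹ (i l) (j l)| ≤ |A i j| :=
      (hA i j _ hy).trans (le_abs_self _)
    calc _ ≤ |A i j| * (C i * s) * (C j * s) :=
          mul_le_mul (mul_le_mul h2 (hC' i u _ hy) (abs_nonneg _) (abs_nonneg _))
            (hC' j u _ hy) (abs_nonneg _)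
            (mul_nonneg (abs_nonneg _) (mul_nonneg (hC _) hs0))
      _ = _ := by ring
  have h2 : s ≤ Q * ∑ j ∈ Finset.range (k + 1), covDerivNorm g j u x := by
    rw [hQ, Finset.sum_mul]
    refine Finset.sum_le_sum fun j hj => ?_
    rw [Finset.sum_mul]
    refine Finset.sum_le_sum fun i _ => ?_
    calc |covDeriv g e u j i (e x)|
        ≤ √(∏ l, gram g e (e x) (i l) (i l)) * covDerivNorm g j u x := by
          rw [covDerivNorm_eq g he (hKe hx)]
          exact abs_le_sqrt_tensorNormSq_inv (gram_posDef g he (hKt hy))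
            (fun i => covDeriv g e u j i (e x)) i
      _ ≤ |B j i| * ∑ j ∈ Finset.range (k + 1), covDerivNorm g j u x :=
          mul_le_mul (((le_abs_self _).trans (hB j i _ hy)).trans (le_abs_self _))
            (Finset.single_le_sum (f := fun j => covDerivNorm g j u x)
              (fun j _ => covDerivNorm_nonneg g j u x) hj)
            (covDerivNorm_nonneg _ _ _ _) (abs_nonneg _)
  rw [mul_assoc]
  exact h1.trans (mul_le_mul_of_nonneg_left h2 (Real.sqrt_nonneg _))

/-- The Leibniz rule, as a bound. -/
theorem exists_covDerivNorm_mul_le (g : Metric d M) (η : C^∞⟮𝓡 d, M; ℝ⟯)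
    (hη : HasCompactSupport η) (k : ℕ) :
    ∃ C : ℝ, 0 ≤ C ∧ ∀ (u : C^∞⟮𝓡 d, M; ℝ⟯) (x : M),
      covDerivNorm g k (η * u : C^∞⟮𝓡 d, M; ℝ⟯) x ≤
        C * ∑ j ∈ Finset.range (k + 1), covDerivNorm g j u x := by
  have : LocallyCompactSpace M := ChartedSpace.locallyCompactSpace (Model d) M
  have hnn : ∀ (u : C^∞⟮𝓡 d, M; ℝ⟯) x, 0 ≤ ∑ j ∈ Finset.range (k + 1), covDerivNorm g j u x :=
    fun u x => Finset.sum_nonneg fun j _ => covDerivNorm_nonneg g j u x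
  have key : ∃ C : ℝ, 0 ≤ C ∧ ∀ u : C^∞⟮𝓡 d, M; ℝ⟯, ∀ x ∈ tsupport η,
      covDerivNorm g k (η * u : C^∞⟮𝓡 d, M; ℝ⟯) x ≤
        C * ∑ j ∈ Finset.range (k + 1), covDerivNorm g j u x := by
    -- The existence of a bound passes to subsets and finite unions, so it is enough to have it on a
    -- compact chart neighbourhood of each point.
    refine hη.isCompact.induction_on (p := fun s => ∃ C : ℝ, 0 ≤ C ∧
      ∀ u : C^∞⟮𝓡 d, M; ℝ⟯, ∀ x ∈ s, covDerivNorm g k (η * u : C^∞⟮𝓡 d, M; ℝ⟯) x ≤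
        C * ∑ j ∈ Finset.range (k + 1), covDerivNorm g j u x)
      ⟨0, le_rfl, fun u x hx => hx.elim⟩ ?_ ?_ ?_
    · rintro s t hst ⟨C, hC, h⟩
      exact ⟨C, hC, fun u x hx => h u x (hst hx)⟩
    · rintro s t ⟨C, hC, h⟩ ⟨C', hC', h'⟩
      refine ⟨max C C', le_max_of_le_left hC, fun u x hx => ?_⟩
      rcases hx with hx | hx
      · exact (h u x hx).trans (mul_le_mul_of_nonneg_right (le_max_left _ _) (hnn u x))
      · exact (h' u x hx).trans (mul_le_mul_of_nonneg_right (le_max_right _ _) (hnn u x))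
    · intro x _
      obtain ⟨K, hK, hKs, hKc⟩ := local_compact_nhds
        ((chartAt (Model d) x).open_source.mem_nhds (mem_chart_source _ x))
      exact ⟨K, mem_nhdsWithin_of_mem_nhds hK,
        exists_covDerivNorm_mul_le_of_chart g (chart_mem_atlas _ x) η k hKc hKs⟩
  obtain ⟨C, hC, h⟩ := key
  refine ⟨C, hC, fun u x => ?_⟩
  by_cases hx : x ∈ tsupport η
  · exact h u x hx
  · rw [covDerivNorm_eq_zero]
    · exact mul_nonneg hC (hnn u x)
    · filter_upwards [notMem_tsupport_iff_eventuallyEq.1 hx] with z hz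
      simp [hz]

end Leibniz

/-! ### The Riemannian measure is finite on compact sets -/

section RiemannianMeasure
variable {d : ℕ} {M : Type*} [TopologicalSpace M] [ChartedSpace (Model d) M]
  [IsManifold (𝓡 d) ∞ M] [MeasurableSpace M] [BorelSpace M]
variable {e e' : OpenPartialHomeomorph M (Model d)}

theorem measurableSet_target_inter_preimage (e : OpenPartialHomeomorph M (Model d)) {s : Set M}
    (hs : MeasurableSet s) : MeasurableSet (e.target ∩ e.symm ⁻¹' s) := by
  have h := (continuousOn_iff_continuous_domRestrict.1 e.continuousOn_symm).measurable hs
  rw [← Subtype.image_preimage_coe]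
  exact e.open_target.measurableSet.subtype_image h

theorem chartMeasure_apply (g : Metric d M) (e : OpenPartialHomeomorph M (Model d)) {s : Set M}
    (hs : MeasurableSet s) : chartMeasure g e s =
      ∫⁻ y in e.target ∩ e.symm ⁻¹' s, ENNReal.ofReal √(gram g e y).det := by
  have h1 : AEMeasurable e.symm ((volume : Measure (Model d)).restrict e.target) :=
    e.continuousOn_symm.aemeasurable e.open_target.measurableSet
  rw [chartMeasure, Measure.map_apply_of_aemeasurable
    (h1.mono_ac (withDensity_absolutelyContinuous _ _)) hs, withDensity_apply',
    Measure.restrict_restrict' e.open_target.measurableSet, inter_comm]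

theorem det_gram_transition (g : Metric d M) (he : e ∈ atlas (Model d) M)
    (he' : e' ∈ atlas (Model d) M) {y : Model d} (hy : y ∈ e'.target ∩ e'.symm ⁻¹' e.source) :
    √(gram g e' y).det = |(fderiv ℝ (fun y => e (e'.symm y)) y).det| *
      √(gram g e (e (e'.symm y))).det := by
  have hJ : (fderiv ℝ (fun y => e (e'.symm y)) y).det = (jacobian e e' y).det := by
    rw [ContinuousLinearMap.det,
      ← LinearMap.det_toMatrix (EuclideanSpace.basisFun (Fin d) ℝ).toBasis]
    congr 1
  rw [gram_transition g he he' hy, hJ, Matrix.det_mul, Matrix.det_mul, Matrix.det_transpose,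
    mul_comm, ← mul_assoc, ← sq, Real.sqrt_mul (sq_nonneg _), Real.sqrt_sq_eq_abs]

/-- Change of variables along the transition map: its Jacobian factor is exactly the ratio of the
two densities `√det g`. -/
theorem chartMeasure_congr (g : Metric d M) (he : e ∈ atlas (Model d) M)
    (he' : e' ∈ atlas (Model d) M) {s : Set M} (hs : MeasurableSet s)
    (hse : s ⊆ e.source) (hse' : s ⊆ e'.source) : chartMeasure g e' s = chartMeasure g e s := by
  rw [chartMeasure_apply g e' hs, chartMeasure_apply g e hs]
  have himg : (fun y => e (e'.symm y)) '' (e'.target ∩ e'.symm ⁻¹' s) =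
      e.target ∩ e.symm ⁻¹' s := by
    ext z
    constructor
    · rintro ⟨y, ⟨hy, hys⟩, rfl⟩
      exact ⟨e.map_source (hse hys), by simpa [e.left_inv (hse hys)] using hys⟩
    · rintro ⟨hz, hzs⟩
      exact ⟨e' (e.symm z), ⟨e'.map_source (hse' hzs), by simpa [e'.left_inv (hse' hzs)] using hzs⟩,
        by simp [e'.left_inv (hse' hzs), e.right_inv hz]⟩
  have hsub : ∀ y ∈ e'.target ∩ e'.symm ⁻¹' s, y ∈ e'.target ∩ e'.symm ⁻¹' e.source :=
    fun y hy => ⟨hy.1, hse hy.2⟩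
  have hmeas : MeasurableSet (e'.target ∩ e'.symm ⁻¹' s) :=
    measurableSet_target_inter_preimage e' hs
  have hinj : InjOn (fun y => e (e'.symm y)) (e'.target ∩ e'.symm ⁻¹' s) := fun y hy z hz h =>
    e'.symm.injOn hy.1 hz.1 (e.injOn (hse hy.2) (hse hz.2) h)
  rw [← himg, lintegral_image_eq_lintegral_abs_det_fderiv_mul volume hmeas
    (fun y hy => (hasFDerivAt_transition he he' (hsub y hy)).hasFDerivWithinAt) hinj]
  refine setLIntegral_congr_fun hmeas fun y hy => ?_
  rw [det_gram_transition g he he' (hsub y hy), ENNReal.ofReal_mul (abs_nonneg _)]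

/-- A supremum of measures lies below any common upper bound, so it suffices to exhibit one that
reduces to the chart measure on `e.source`. -/
theorem riemannianMeasure_restrict_source_le (g : Metric d M) (he : e ∈ atlas (Model d) M) :
    (riemannianMeasure g).restrict e.source ≤ chartMeasure g e := by
  have hm : MeasurableSet e.source := e.open_source.measurableSet
  -- A chart measure of `e'` agrees with that of `e` on the overlap, vanishes off `e'.source`, and
  -- off `e.source` is absorbed by `⊤`.
  have h : riemannianMeasure g ≤ chartMeasure g e + (⊤ : Measure M).restrict e.sourceᶜ := by
    refine iSup₂_le fun e' he' => ?_
    rw [Measure.le_iff]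
    intro s hs
    have h1 : MeasurableSet (s ∩ e.source ∩ e'.source) :=
      (hs.inter hm).inter e'.open_source.measurableSet
    have h2 : chartMeasure g e' e'.sourceᶜ = 0 := by
      rw [chartMeasure_apply g e' e'.open_source.measurableSet.compl]
      have : e'.target ∩ e'.symm ⁻¹' e'.sourceᶜ = ∅ := by
        ext y
        simp only [mem_inter_iff, mem_preimage, mem_compl_iff, mem_empty_iff_false, iff_false,
          not_and, not_not]
        exact fun hy => e'.map_target hy
      rw [this, Measure.restrict_empty, lintegral_zero_measure]
    calc chartMeasure g e' s
        ≤ chartMeasure g e' (s ∩ e.source ∩ e'.source) + chartMeasure g e' (s ∩ e.sourceᶜ)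
          + chartMeasure g e' e'.sourceᶜ := by
          refine (measure_mono (t := (s ∩ e.source ∩ e'.source ∪ (s ∩ e.sourceᶜ)) ∪ e'.sourceᶜ)
            ?_).trans ((measure_union_le _ _).trans (add_le_add_left (measure_union_le _ _) _))
          intro x hx
          by_cases h3 : x ∈ e.source <;> by_cases h4 : x ∈ e'.source <;> simp [hx, h3, h4]
      _ ≤ chartMeasure g e s + (⊤ : Measure M).restrict e.sourceᶜ s := by
          rw [h2, add_zero, chartMeasure_congr g he he' h1 (fun x hx => hx.1.2) (fun x hx => hx.2)]
          refine add_le_add (measure_mono fun x hx => hx.1.1) ?_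
          rw [Measure.restrict_apply hs]
          exact (le_top : chartMeasure g e' ≤ ⊤) _
  calc (riemannianMeasure g).restrict e.source
      ≤ (chartMeasure g e + (⊤ : Measure M).restrict e.sourceᶜ).restrict e.source :=
        Measure.restrict_mono_measure h _
    _ = (chartMeasure g e).restrict e.source := by
        rw [Measure.restrict_add, Measure.restrict_restrict hm]
        simp
    _ ≤ chartMeasure g e := Measure.restrict_le_self

/-- Each point has a compact neighbourhood inside a chart; there the density is continuous on a
compact set, hence integrable. -/
instance isFiniteMeasureOnCompacts_riemannianMeasure (g : Metric d M) [T2Space M] :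
    IsFiniteMeasureOnCompacts (riemannianMeasure g) := by
  have : LocallyCompactSpace M := ChartedSpace.locallyCompactSpace (Model d) M
  have : IsLocallyFiniteMeasure (riemannianMeasure g) := by
    refine ⟨fun x => ?_⟩
    set e := chartAt (Model d) x with hedef
    have he : e ∈ atlas (Model d) M := chart_mem_atlas _ _
    obtain ⟨K, hK, hKs, hKc⟩ := local_compact_nhds
      (e.open_source.mem_nhds (mem_chart_source _ x))
    refine ⟨K, hK, ?_⟩
    have hKm : MeasurableSet K := hKc.measurableSet
    have h1 : riemannianMeasure g K ≤ chartMeasure g e K := by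
      rw [← inter_eq_left.2 hKs, ← Measure.restrict_apply (hKm), inter_eq_left.2 hKs]
      exact riemannianMeasure_restrict_source_le g he K
    refine h1.trans_lt ?_
    rw [chartMeasure_apply g e hKm]
    have h2 : e.target ∩ e.symm ⁻¹' K = e '' K := by
      rw [e.image_eq_target_inter_inv_preimage hKs]
    have h3 : e '' K ⊆ e.target := h2 ▸ inter_subset_left
    have h4 : IsCompact (e '' K) := hKc.image_of_continuousOn (e.continuousOn.mono hKs)
    rw [h2]
    have h5 : ContinuousOn (fun y => √(gram g e y).det) (e '' K) :=
      ((contDiffOn_gram_det g he).continuousOn.mono h3).sqrt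
    have h6 := (h5.integrableOn_compact (μ := volume) h4).lintegral_lt_top
    exact h6
  infer_instance

end RiemannianMeasure

/-! ### The Sobolev norm of smooth functions -/

section SmoothSobolevNorm
variable {d : ℕ} {M : Type*} [TopologicalSpace M] [SecondCountableTopology M] [T2Space M]
  [ChartedSpace (Model d) M] [IsManifold (𝓡 d) ∞ M] [MeasurableSpace M] [BorelSpace M]

theorem aestronglyMeasurable_smooth (g : Metric d M) (u : C^∞⟮𝓡 d, M; ℝ⟯) :
    AEStronglyMeasurable u (riemannianMeasure g) :=
  u.contMDiff.continuous.aestronglyMeasurable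

theorem aestronglyMeasurable_covDerivNorm (g : Metric d M) (k : ℕ) (u : C^∞⟮𝓡 d, M; ℝ⟯) :
    AEStronglyMeasurable (covDerivNorm g k u) (riemannianMeasure g) :=
  (continuous_covDerivNorm g k u).aestronglyMeasurable

theorem smoothSobolevNorm_add_le (g : Metric d M) (r : ℕ) {p : ℝ≥0∞} (hp : 1 ≤ p)
    (u v : C^∞⟮𝓡 d, M; ℝ⟯) :
    smoothSobolevNorm g r p (u + v) ≤ smoothSobolevNorm g r p u + smoothSobolevNorm g r p v := by
  simp only [smoothSobolevNorm]
  rw [← Finset.sum_add_distrib]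
  refine Finset.sum_le_sum fun k _ => le_trans ?_ (eLpNorm_add_le
    (aestronglyMeasurable_covDerivNorm g k u) (aestronglyMeasurable_covDerivNorm g k v) hp)
  refine eLpNorm_mono_real fun x => ?_
  rw [Real.norm_of_nonneg (covDerivNorm_nonneg _ _ _ _)]
  exact covDerivNorm_add_le g k u v x

theorem smoothSobolevNorm_smul (g : Metric d M) (r : ℕ) (p : ℝ≥0∞) (c : ℝ)
    (u : C^∞⟮𝓡 d, M; ℝ⟯) :
    smoothSobolevNorm g r p (c • u) = ‖c‖ₑ * smoothSobolevNorm g r p u := by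
  simp only [smoothSobolevNorm, Finset.mul_sum]
  refine Finset.sum_congr rfl fun k _ => ?_
  have h : covDerivNorm g k (c • u : C^∞⟮𝓡 d, M; ℝ⟯) = |c| • covDerivNorm g k u := by
    ext x
    exact covDerivNorm_smul g k c u x
  rw [h, eLpNorm_const_smul, Real.enorm_abs]

theorem smoothSobolevNorm_zero (g : Metric d M) (r : ℕ) (p : ℝ≥0∞) :
    smoothSobolevNorm g r p 0 = 0 := by
  have h := smoothSobolevNorm_smul g r p 0 0
  rwa [zero_smul, enorm_zero, zero_mul] at h

theorem smoothSobolevNorm_sub_comm (g : Metric d M) (r : ℕ) (p : ℝ≥0∞)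
    (u v : C^∞⟮𝓡 d, M; ℝ⟯) :
    smoothSobolevNorm g r p (u - v) = smoothSobolevNorm g r p (v - u) := by
  have h := smoothSobolevNorm_smul g r p (-1) (u - v)
  rw [neg_one_smul, neg_sub, enorm_neg, enorm_one, one_mul] at h
  exact h.symm

theorem smoothSobolevNorm_sub_le (g : Metric d M) (r : ℕ) {p : ℝ≥0∞} (hp : 1 ≤ p)
    (u v w : C^∞⟮𝓡 d, M; ℝ⟯) :
    smoothSobolevNorm g r p (u - w) ≤
      smoothSobolevNorm g r p (u - v) + smoothSobolevNorm g r p (v - w) := by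
  rw [← sub_add_sub_cancel u v w]
  exact smoothSobolevNorm_add_le g r hp _ _

theorem eLpNorm_le_smoothSobolevNorm (g : Metric d M) (r : ℕ) (p : ℝ≥0∞)
    (u : C^∞⟮𝓡 d, M; ℝ⟯) :
    eLpNorm u p (riemannianMeasure g) ≤ smoothSobolevNorm g r p u := by
  have h : eLpNorm u p (riemannianMeasure g) =
      eLpNorm (covDerivNorm g 0 u) p (riemannianMeasure g) :=
    eLpNorm_congr_norm_ae (ae_of_all _ fun x => by simp [covDerivNorm_zero])
  rw [h]
  exact Finset.single_le_sum (f := fun k => eLpNorm (covDerivNorm g k u) p (riemannianMeasure g))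
    (fun _ _ => zero_le) (Finset.mem_range.2 (Nat.succ_pos r))

theorem exists_smoothSobolevNorm_mul_le (g : Metric d M) (r : ℕ) {p : ℝ≥0∞} (hp : 1 ≤ p)
    (η : C^∞⟮𝓡 d, M; ℝ⟯) (hη : HasCompactSupport η) :
    ∃ C : ℝ≥0∞, C ≠ ⊤ ∧ ∀ u : C^∞⟮𝓡 d, M; ℝ⟯,
      smoothSobolevNorm g r p (η * u) ≤ C * smoothSobolevNorm g r p u := by
  choose C hC hle using exists_covDerivNorm_mul_le g η hη
  refine ⟨∑ k ∈ Finset.range (r + 1), ENNReal.ofReal (C k), by simp, fun u => ?_⟩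
  rw [Finset.sum_mul, smoothSobolevNorm]
  refine Finset.sum_le_sum fun k hk => ?_
  calc eLpNorm (covDerivNorm g k (η * u : C^∞⟮𝓡 d, M; ℝ⟯)) p (riemannianMeasure g)
      ≤ eLpNorm (C k • ∑ j ∈ Finset.range (k + 1), covDerivNorm g j u) p
          (riemannianMeasure g) := by
        refine eLpNorm_mono_real fun x => ?_
        rw [Real.norm_of_nonneg (covDerivNorm_nonneg _ _ _ _)]
        simpa using hle k u x
    _ = ENNReal.ofReal (C k) * eLpNorm (∑ j ∈ Finset.range (k + 1), covDerivNorm g j u) p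
          (riemannianMeasure g) := by
        rw [eLpNorm_const_smul, ← ofReal_norm, Real.norm_of_nonneg (hC k)]
    _ ≤ ENNReal.ofReal (C k) * smoothSobolevNorm g r p u := by
        gcongr
        refine (eLpNorm_sum_le (fun j _ => aestronglyMeasurable_covDerivNorm g j u) hp).trans ?_
        exact Finset.sum_le_sum_of_subset
          (Finset.range_subset_range.2 (by have := Finset.mem_range.1 hk; omega))

theorem smoothSobolevNorm_lt_top (g : Metric d M) (r : ℕ) (p : ℝ≥0∞)
    (u : C^∞⟮𝓡 d, M; ℝ⟯) (hu : HasCompactSupport u) : smoothSobolevNorm g r p u < ⊤ := by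
  refine ENNReal.sum_lt_top.2 fun k _ => ?_
  have h : HasCompactSupport (covDerivNorm g k u) :=
    hu.mono' (support_covDerivNorm_subset g k u)
  exact ((continuous_covDerivNorm g k u).memLp_of_hasCompactSupport h).2

end SmoothSobolevNorm

/-! ### The completion and its norm -/

section SobolevNorm
variable {d : ℕ} {M : Type*} [TopologicalSpace M] [SecondCountableTopology M] [T2Space M]
  [ChartedSpace (Model d) M] [IsManifold (𝓡 d) ∞ M] [MeasurableSpace M] [BorelSpace M]
variable {g : Metric d M} {r : ℕ} {p : ℝ≥0∞}

namespace IsSobolevApprox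
variable {u v : ℕ → C^∞⟮𝓡 d, M; ℝ⟯} {f h : M → ℝ}

theorem congr (hu : IsSobolevApprox g r p u f) (hfh : f =ᵐ[riemannianMeasure g] h) :
    IsSobolevApprox g r p u h where
  finite := hu.finite
  cauchy := hu.cauchy
  measurable := hu.measurable.congr hfh
  tendsto := hu.tendsto.congr fun n => eLpNorm_congr_ae (hfh.mono fun x hx => by simp only [hx])

/-- Only `n ≤ φ n` matters, not monotonicity; this covers both shifts and the diagonal choice of
indices in the completeness proof. -/
theorem comp (hu : IsSobolevApprox g r p u f) {φ : ℕ → ℕ} (hφ : ∀ n, n ≤ φ n) :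
    IsSobolevApprox g r p (u ∘ φ) f where
  finite n := hu.finite _
  cauchy ε hε := by
    obtain ⟨N, hN⟩ := hu.cauchy ε hε
    exact ⟨N, fun m hm n hn => hN _ (hm.trans (hφ m)) _ (hn.trans (hφ n))⟩
  measurable := hu.measurable
  tendsto := hu.tendsto.comp (tendsto_atTop_mono hφ tendsto_id)

theorem const {w : C^∞⟮𝓡 d, M; ℝ⟯} (hw : smoothSobolevNorm g r p w < ⊤) :
    IsSobolevApprox g r p (fun _ => w) w where
  finite _ := hw
  cauchy ε _ := ⟨0, fun m _ n _ => by rw [sub_self, smoothSobolevNorm_zero]; exact zero_le⟩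
  measurable := aestronglyMeasurable_smooth g w
  tendsto := by simp

theorem add (hp : 1 ≤ p) (hu : IsSobolevApprox g r p u f) (hv : IsSobolevApprox g r p v h) :
    IsSobolevApprox g r p (u + v) (fun x => f x + h x) where
  finite n := (smoothSobolevNorm_add_le g r hp _ _).trans_lt
    (ENNReal.add_lt_top.2 ⟨hu.finite n, hv.finite n⟩)
  cauchy ε hε := by
    obtain ⟨N, hN⟩ := hu.cauchy (ε / 2) (ENNReal.half_pos hε.ne')
    obtain ⟨N', hN'⟩ := hv.cauchy (ε / 2) (ENNReal.half_pos hε.ne')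
    refine ⟨max N N', fun m hm n hn => ?_⟩
    rw [Pi.add_apply, Pi.add_apply, add_sub_add_comm, ← ENNReal.add_halves ε]
    exact (smoothSobolevNorm_add_le g r hp _ _).trans (add_le_add
      (hN m (le_of_max_le_left hm) n (le_of_max_le_left hn))
      (hN' m (le_of_max_le_right hm) n (le_of_max_le_right hn)))
  measurable := hu.measurable.add hv.measurable
  tendsto := by
    have h0 := hu.tendsto.add hv.tendsto
    rw [add_zero] at h0
    refine tendsto_of_tendsto_of_tendsto_of_le_of_le tendsto_const_nhds h0
      (fun _ => zero_le) fun n => ?_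
    refine le_trans (le_of_eq ?_) (eLpNorm_add_le
      ((aestronglyMeasurable_smooth g (u n)).sub hu.measurable)
      ((aestronglyMeasurable_smooth g (v n)).sub hv.measurable) hp)
    congr 1
    ext x
    simp only [Pi.add_apply, ContMDiffMap.coe_add]
    ring

theorem smul (c : ℝ) (hu : IsSobolevApprox g r p u f) :
    IsSobolevApprox g r p (c • u) (fun x => c * f x) where
  finite n := by
    rw [Pi.smul_apply, smoothSobolevNorm_smul]
    exact ENNReal.mul_lt_top enorm_lt_top (hu.finite n)
  cauchy ε hε := by
    obtain ⟨N, hN⟩ := hu.cauchy (ε / ‖c‖ₑ) (ENNReal.div_pos hε.ne' enorm_ne_top)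
    refine ⟨N, fun m hm n hn => ?_⟩
    rw [Pi.smul_apply, Pi.smul_apply, ← smul_sub, smoothSobolevNorm_smul]
    exact (mul_le_mul_right (hN m hm n hn) _).trans ENNReal.mul_div_le
  measurable := hu.measurable.const_mul c
  tendsto := by
    have h0 := ENNReal.Tendsto.const_mul (a := ‖c‖ₑ) hu.tendsto (Or.inr enorm_ne_top)
    rw [mul_zero] at h0
    refine h0.congr fun n => ?_
    rw [← eLpNorm_const_smul]
    congr 1
    ext x
    simp [mul_sub]

theorem sub (hp : 1 ≤ p) (hu : IsSobolevApprox g r p u f) (hv : IsSobolevApprox g r p v h) :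
    IsSobolevApprox g r p (u - v) (fun x => f x - h x) := by
  have h1 := hu.add hp (hv.smul (-1))
  simpa [← sub_eq_add_neg] using h1

theorem mul (hp : 1 ≤ p) (η : C^∞⟮𝓡 d, M; ℝ⟯) (hη : HasCompactSupport η)
    (hu : IsSobolevApprox g r p u f) :
    IsSobolevApprox g r p (fun n => η * u n) (fun x => η x * f x) := by
  obtain ⟨C, hC, hle⟩ := exists_smoothSobolevNorm_mul_le g r hp η hη
  refine ⟨fun n => (hle _).trans_lt (ENNReal.mul_lt_top hC.lt_top (hu.finite n)), ?_,
    (aestronglyMeasurable_smooth g η).mul hu.measurable, ?_⟩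
  · intro ε hε
    obtain ⟨N, hN⟩ := hu.cauchy (ε / C) (ENNReal.div_pos hε.ne' hC)
    refine ⟨N, fun m hm n hn => ?_⟩
    rw [← mul_sub]
    exact (hle _).trans ((mul_le_mul_right (hN m hm n hn) _).trans ENNReal.mul_div_le)
  · obtain ⟨D, hD⟩ := hη.exists_bound_of_continuous η.contMDiff.continuous
    have h0 := ENNReal.Tendsto.const_mul (a := ENNReal.ofReal D) hu.tendsto
      (Or.inr ENNReal.ofReal_ne_top)
    rw [mul_zero] at h0
    refine tendsto_of_tendsto_of_tendsto_of_le_of_le tendsto_const_nhds h0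
      (fun _ => zero_le) fun n => ?_
    refine eLpNorm_le_mul_eLpNorm_of_ae_le_mul (ae_of_all _ fun x => ?_) p
    rw [ContMDiffMap.coe_mul, Pi.mul_apply, ← mul_sub, norm_mul]
    exact mul_le_mul_of_nonneg_right (hD x) (norm_nonneg _)

end IsSobolevApprox

theorem sobolevNorm_le_of_eventually {u : ℕ → C^∞⟮𝓡 d, M; ℝ⟯} {f : M → ℝ} {a : ℝ≥0∞}
    (hu : IsSobolevApprox g r p u f) (h : ∀ᶠ n in atTop, smoothSobolevNorm g r p (u n) ≤ a) :
    sobolevNorm g r p f ≤ a :=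
  (iInf₂_le u hu).trans (limsup_le_of_le (by isBoundedDefault) h)

/-- The infimum gives a sequence whose `limsup` is below `a`; dropping finitely many terms makes
every term so. With `sobolevNorm_le_of_eventually`, this reduces norm estimates to smooth functions.
-/
theorem exists_isSobolevApprox_of_sobolevNorm_lt {f : M → ℝ} {a : ℝ≥0∞}
    (h : sobolevNorm g r p f < a) : ∃ u, IsSobolevApprox g r p u f ∧
      ∀ n, smoothSobolevNorm g r p (u n) < a := by
  simp only [sobolevNorm, iInf_lt_iff] at h
  obtain ⟨u, hu, h⟩ := h
  obtain ⟨N, hN⟩ := eventually_atTop.1 (eventually_lt_of_limsup_lt h)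
  exact ⟨_, hu.comp (φ := fun n => n + N) (fun n => Nat.le_add_right n N),
    fun n => hN _ (Nat.le_add_left N n)⟩

theorem MemSobolev.sobolevNorm_lt_top {f : M → ℝ} (hp : 1 ≤ p) (hf : MemSobolev g r p f) :
    sobolevNorm g r p f < ⊤ := by
  obtain ⟨u, hu⟩ := hf
  obtain ⟨N, hN⟩ := hu.cauchy 1 one_pos
  refine (sobolevNorm_le_of_eventually hu (a := 1 + smoothSobolevNorm g r p (u N)) ?_).trans_lt
    (ENNReal.add_lt_top.2 ⟨ENNReal.one_lt_top, hu.finite N⟩)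
  filter_upwards [eventually_ge_atTop N] with n hn
  calc smoothSobolevNorm g r p (u n) = smoothSobolevNorm g r p (u n - u N + u N) := by
        rw [sub_add_cancel]
    _ ≤ _ := smoothSobolevNorm_add_le g r hp _ _
    _ ≤ _ := by gcongr; exact hN n hn N le_rfl

theorem sobolevNorm_congr {f h : M → ℝ} (hfh : f =ᵐ[riemannianMeasure g] h) :
    sobolevNorm g r p f = sobolevNorm g r p h := by
  have : ∀ u, IsSobolevApprox g r p u f ↔ IsSobolevApprox g r p u h :=
    fun u => ⟨fun hu => hu.congr hfh, fun hu => hu.congr hfh.symm⟩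
  simp only [sobolevNorm, this]

theorem MemSobolev.congr {f h : M → ℝ} (hf : MemSobolev g r p f)
    (hfh : f =ᵐ[riemannianMeasure g] h) : MemSobolev g r p h :=
  hf.imp fun _ hu => hu.congr hfh

theorem MemSobolev.add (hp : 1 ≤ p) {f h : M → ℝ} (hf : MemSobolev g r p f)
    (hh : MemSobolev g r p h) : MemSobolev g r p (fun x => f x + h x) := by
  obtain ⟨u, hu⟩ := hf
  obtain ⟨v, hv⟩ := hh
  exact ⟨_, hu.add hp hv⟩

theorem MemSobolev.sub (hp : 1 ≤ p) {f h : M → ℝ} (hf : MemSobolev g r p f)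
    (hh : MemSobolev g r p h) : MemSobolev g r p (fun x => f x - h x) := by
  obtain ⟨u, hu⟩ := hf
  obtain ⟨v, hv⟩ := hh
  exact ⟨_, hu.sub hp hv⟩

theorem MemSobolev.smul (c : ℝ) {f : M → ℝ} (hf : MemSobolev g r p f) :
    MemSobolev g r p (fun x => c * f x) := by
  obtain ⟨u, hu⟩ := hf
  exact ⟨_, hu.smul c⟩

theorem MemSobolev.mul (hp : 1 ≤ p) (η : C^∞⟮𝓡 d, M; ℝ⟯) (hη : HasCompactSupport η)
    {f : M → ℝ} (hf : MemSobolev g r p f) : MemSobolev g r p (fun x => η x * f x) := by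
  obtain ⟨u, hu⟩ := hf
  exact ⟨_, hu.mul hp η hη⟩

theorem memSobolev_of_smooth {w : C^∞⟮𝓡 d, M; ℝ⟯} (hw : smoothSobolevNorm g r p w < ⊤) :
    MemSobolev g r p w := ⟨_, IsSobolevApprox.const hw⟩

theorem sobolevNorm_zero : sobolevNorm g r p (fun _ => 0) = 0 := by
  have h : IsSobolevApprox g r p (fun _ => (0 : C^∞⟮𝓡 d, M; ℝ⟯)) (fun _ => 0) :=
    IsSobolevApprox.const (by rw [smoothSobolevNorm_zero]; exact ENNReal.zero_lt_top)
  exact le_antisymm (sobolevNorm_le_of_eventually h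
    (Eventually.of_forall fun _ => (smoothSobolevNorm_zero g r p).le)) zero_le

theorem sobolevNorm_add_le (hp : 1 ≤ p) (f h : M → ℝ) :
    sobolevNorm g r p (fun x => f x + h x) ≤ sobolevNorm g r p f + sobolevNorm g r p h := by
  refine ENNReal.le_of_forall_pos_le_add fun ε hε hlt => ?_
  have hε2 : (ε / 2 : ℝ≥0∞) ≠ 0 := (ENNReal.half_pos (by exact_mod_cast hε.ne')).ne'
  obtain ⟨hf, hh⟩ := ENNReal.add_lt_top.1 hlt
  obtain ⟨u, hu, hu'⟩ := exists_isSobolevApprox_of_sobolevNorm_lt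
    (ENNReal.lt_add_right hf.ne hε2)
  obtain ⟨v, hv, hv'⟩ := exists_isSobolevApprox_of_sobolevNorm_lt
    (ENNReal.lt_add_right hh.ne hε2)
  refine sobolevNorm_le_of_eventually (hu.add hp hv) (Eventually.of_forall fun n => ?_)
  calc smoothSobolevNorm g r p (u n + v n)
      ≤ smoothSobolevNorm g r p (u n) + smoothSobolevNorm g r p (v n) :=
        smoothSobolevNorm_add_le g r hp _ _
    _ ≤ (sobolevNorm g r p f + ε / 2) + (sobolevNorm g r p h + ε / 2) :=
        add_le_add (hu' n).le (hv' n).le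
    _ = sobolevNorm g r p f + sobolevNorm g r p h + ε := by
        rw [add_add_add_comm, ENNReal.add_halves]

/-- Let `c` decrease to `a`. Representatives come only with norms below a number strictly larger
than `sobolevNorm`, so operator bounds need this limit. -/
theorem le_mul_of_forall_gt_ennreal {a b C : ℝ≥0∞} (ha : a ≠ ⊤) (hC : C ≠ ⊤)
    (h : ∀ c, a < c → b ≤ C * c) : b ≤ C * a := by
  have h1 : Tendsto (fun c => C * c) (𝓝[>] a) (𝓝 (C * a)) :=
    (ENNReal.Tendsto.const_mul tendsto_id (Or.inr hC)).mono_left nhdsWithin_le_nhds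
  have : (𝓝[>] a).NeBot := nhdsGT_neBot_of_exists_gt ⟨⊤, ha.lt_top⟩
  exact ge_of_tendsto h1 (eventually_nhdsWithin_of_forall h)

theorem sobolevNorm_smul_le (hp : 1 ≤ p) (c : ℝ) {f : M → ℝ} (hf : MemSobolev g r p f) :
    sobolevNorm g r p (fun x => c * f x) ≤ ‖c‖ₑ * sobolevNorm g r p f := by
  refine le_mul_of_forall_gt_ennreal (hf.sobolevNorm_lt_top hp).ne enorm_ne_top fun a ha => ?_
  obtain ⟨u, hu, hu'⟩ := exists_isSobolevApprox_of_sobolevNorm_lt ha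
  refine sobolevNorm_le_of_eventually (hu.smul c) (Eventually.of_forall fun n => ?_)
  rw [Pi.smul_apply, smoothSobolevNorm_smul]
  exact mul_le_mul_right (hu' n).le _

theorem exists_sobolevNorm_mul_le (g : Metric d M) (r : ℕ) (hp : 1 ≤ p) (η : C^∞⟮𝓡 d, M; ℝ⟯)
    (hη : HasCompactSupport η) : ∃ C : ℝ≥0∞, C ≠ ⊤ ∧ ∀ f : M → ℝ, MemSobolev g r p f →
      sobolevNorm g r p (fun x => η x * f x) ≤ C * sobolevNorm g r p f := by
  obtain ⟨C, hC, hle⟩ := exists_smoothSobolevNorm_mul_le g r hp η hη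
  refine ⟨C, hC, fun f hf => ?_⟩
  refine le_mul_of_forall_gt_ennreal (hf.sobolevNorm_lt_top hp).ne hC fun a ha => ?_
  obtain ⟨u, hu, hu'⟩ := exists_isSobolevApprox_of_sobolevNorm_lt ha
  exact sobolevNorm_le_of_eventually (hu.mul hp η hη) (Eventually.of_forall fun n =>
    (hle _).trans (mul_le_mul_right (hu' n).le _))

theorem sobolevNorm_sub_le (hp : 1 ≤ p) (f h w : M → ℝ) :
    sobolevNorm g r p (fun x => f x - w x) ≤
      sobolevNorm g r p (fun x => f x - h x) + sobolevNorm g r p (fun x => h x - w x) := by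
  simpa using sobolevNorm_add_le (g := g) (r := r) hp (fun x => f x - h x) (fun x => h x - w x)

theorem MemSobolev.memLp {f : M → ℝ} (hf : MemSobolev g r p f) :
    MemLp f p (riemannianMeasure g) := by
  obtain ⟨u, hu⟩ := hf
  obtain ⟨n, hn⟩ := (hu.tendsto.eventually (gt_mem_nhds one_pos)).exists
  have h1 : MemLp (u n) p (riemannianMeasure g) :=
    ⟨aestronglyMeasurable_smooth g _, (eLpNorm_le_smoothSobolevNorm g r p _).trans_lt (hu.finite n)⟩
  have h2 : MemLp (fun x => u n x - f x) p (riemannianMeasure g) :=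
    ⟨(aestronglyMeasurable_smooth g _).sub hu.measurable, hn.trans ENNReal.one_lt_top⟩
  convert h1.sub h2 using 1
  ext x
  simp

/-- Split `f = u n - (u n - f)`: the first part is bounded by the Sobolev norm of `u n`, the second
tends to `0` in `L^p`. -/
theorem eLpNorm_le_sobolevNorm (hp : 1 ≤ p) (f : M → ℝ) :
    eLpNorm f p (riemannianMeasure g) ≤ sobolevNorm g r p f := by
  refine le_of_forall_gt fun a ha => ?_
  obtain ⟨b, hb, hba⟩ := exists_between ha
  obtain ⟨u, hu, hu'⟩ := exists_isSobolevApprox_of_sobolevNorm_lt hb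
  refine lt_of_le_of_lt ?_ hba
  have h1 : Tendsto (fun n => b + eLpNorm (fun x => u n x - f x) p (riemannianMeasure g))
      atTop (𝓝 (b + 0)) := hu.tendsto.const_add b
  rw [add_zero] at h1
  refine ge_of_tendsto' h1 fun n => ?_
  calc eLpNorm f p (riemannianMeasure g)
      = eLpNorm (⇑(u n) - fun x => u n x - f x) p (riemannianMeasure g) := by
        congr 1; ext x; simp
    _ ≤ _ := eLpNorm_sub_le (aestronglyMeasurable_smooth g _)
        ((aestronglyMeasurable_smooth g _).sub hu.measurable) hp
    _ ≤ _ := by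
        gcongr
        exact (eLpNorm_le_smoothSobolevNorm g r p _).trans (hu' n).le

/-- The smooth functions are dense in the Sobolev space. -/
theorem exists_smooth_sobolevNorm_sub_le (hp : 1 ≤ p) {f : M → ℝ} (hf : MemSobolev g r p f)
    {ε : ℝ≥0∞} (hε : 0 < ε) : ∃ w : C^∞⟮𝓡 d, M; ℝ⟯, smoothSobolevNorm g r p w < ⊤ ∧
      sobolevNorm g r p (fun x => f x - w x) ≤ ε := by
  obtain ⟨u, hu⟩ := hf
  obtain ⟨N, hN⟩ := hu.cauchy ε hε
  refine ⟨u N, hu.finite N, sobolevNorm_le_of_eventually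
    (hu.sub hp (IsSobolevApprox.const (hu.finite N))) ?_⟩
  filter_upwards [eventually_ge_atTop N] with n hn using hN n hn N le_rfl

end SobolevNorm

/-! ### Completeness of `W^r_p(M)` -/

section Complete
variable {d : ℕ} {M : Type*} [TopologicalSpace M] [SecondCountableTopology M] [T2Space M]
  [ChartedSpace (Model d) M] [IsManifold (𝓡 d) ∞ M] [MeasurableSpace M] [BorelSpace M]
variable {g : Metric d M} {r : ℕ} {p : ℝ≥0∞}

theorem two_mul_inv_pow_succ (n : ℕ) : 2 * (2⁻¹ : ℝ≥0∞) ^ (n + 1) = 2⁻¹ ^ n := by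
  rw [pow_succ', ← mul_assoc, ENNReal.mul_inv_cancel (by simp) (by simp), one_mul]

theorem exists_two_mul_inv_pow_le {ε : ℝ≥0∞} (hε : 0 < ε) (C : ℝ≥0∞) (hC : C ≠ ⊤) :
    ∃ N : ℕ, ∀ n ≥ N, C * (2⁻¹ : ℝ≥0∞) ^ n ≤ ε := by
  have h : Tendsto (fun n : ℕ => C * (2⁻¹ : ℝ≥0∞) ^ n) atTop (𝓝 (C * 0)) :=
    ENNReal.Tendsto.const_mul (ENNReal.tendsto_pow_atTop_nhds_zero_of_lt_one
      ENNReal.one_half_lt_one) (Or.inr hC)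
  rw [mul_zero] at h
  exact eventually_atTop.1 ((h.eventually (gt_mem_nhds hε)).mono fun n hn => hn.le)

/-- A sequence in the Sobolev space that converges fast has a limit. -/
theorem exists_limit_of_fast_cauchy (hp : 1 ≤ p) {f : ℕ → M → ℝ}
    (hf : ∀ n, MemSobolev g r p (f n))
    (hfast : ∀ n, sobolevNorm g r p (fun x => f (n + 1) x - f n x) < 2⁻¹ ^ n) :
    ∃ h : M → ℝ, MemSobolev g r p h ∧
      ∀ n, sobolevNorm g r p (fun x => f n x - h x) ≤ 2 * 2⁻¹ ^ n := by
  obtain ⟨v, hv⟩ := hf 0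
  -- Representing the increments, rather than each `f n` separately, gives sequences `u n` for `f n`
  -- with `u (n + 1) j - u n j` small for every `j`, not just in the limit.
  choose w hw hwlt using fun n => exists_isSobolevApprox_of_sobolevNorm_lt (hfast n)
  set u : ℕ → ℕ → C^∞⟮𝓡 d, M; ℝ⟯ := fun n => v + ∑ i ∈ Finset.range n, w i with hu_def
  have hsucc : ∀ n, u (n + 1) = u n + w n := fun n => by
    simp only [hu_def, Finset.sum_range_succ, add_assoc]
  have hu : ∀ n, IsSobolevApprox g r p (u n) (f n) := by
    intro n
    induction n with
    | zero => simpa [hu_def] using hv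
    | succ n ih =>
      rw [hsucc]
      simpa using ih.add hp (hw n)
  -- The extra `2 * 2⁻¹ ^ m` is the sum of the remaining geometric tail; each induction step spends
  -- `2⁻¹ ^ m` of it.
  have hdiff : ∀ j n m, n ≤ m →
      smoothSobolevNorm g r p (u m j - u n j) + 2 * 2⁻¹ ^ m ≤ 2 * 2⁻¹ ^ n := by
    intro j n m hnm
    induction m, hnm using Nat.le_induction with
    | base => rw [sub_self, smoothSobolevNorm_zero, zero_add]
    | succ m _ ih =>
      have h1 : smoothSobolevNorm g r p (u (m + 1) j - u n j) ≤
          smoothSobolevNorm g r p (u m j - u n j) + 2⁻¹ ^ m := by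
        have h2 : u (m + 1) j - u n j = (u m j - u n j) + w m j := by
          rw [hsucc, Pi.add_apply]; abel
        rw [h2]
        exact (smoothSobolevNorm_add_le g r hp _ _).trans (add_le_add le_rfl (hwlt m j).le)
      calc _ ≤ smoothSobolevNorm g r p (u m j - u n j) + 2⁻¹ ^ m + 2⁻¹ ^ m := by
            rw [two_mul_inv_pow_succ]; gcongr
        _ = smoothSobolevNorm g r p (u m j - u n j) + 2 * 2⁻¹ ^ m := by rw [two_mul, add_assoc]
        _ ≤ _ := ih
  have hdiff' : ∀ j n m, n ≤ m → smoothSobolevNorm g r p (u m j - u n j) ≤ 2 * 2⁻¹ ^ n :=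
    fun j n m hnm => le_self_add.trans (hdiff j n m hnm)
  choose J₀ hJ₀ using fun n => (hu n).cauchy (2⁻¹ ^ n) (ENNReal.pow_pos (by simp) n)
  -- Past `J₀ n` the sequence `u n` varies by at most `2⁻¹ ^ n`; `J n ≥ n` makes `u n ∘ J` represent
  -- `f n` as well.
  set J : ℕ → ℕ := fun n => max n (J₀ n) with hJ
  have hcauchy : ∀ n, ∀ i ≥ J n, ∀ j ≥ J n,
      smoothSobolevNorm g r p (u n i - u n j) ≤ 2⁻¹ ^ n := fun n i hi j hj =>
    hJ₀ n i (le_of_max_le_right hi) j (le_of_max_le_right hj)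
  set U : ℕ → C^∞⟮𝓡 d, M; ℝ⟯ := fun n => u n (J n) with hU_def
  have hU : ∀ n m, n ≤ m → smoothSobolevNorm g r p (U m - U n) ≤ 4 * 2⁻¹ ^ n := by
    intro n m hnm
    -- A common index past both thresholds: move along `u m` to `j`, cross to `u n` at `j`, and
    -- return along `u n`.
    set j := max (J n) (J m) with hj
    have h1 := hcauchy m (J m) le_rfl j (le_max_right _ _)
    have h2 := hdiff' j n m hnm
    have h3 := hcauchy n j (le_max_left _ _) (J n) le_rfl
    have h4 : (2⁻¹ : ℝ≥0∞) ^ m ≤ 2⁻¹ ^ n :=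
      pow_le_pow_right_of_le_one' (by simp) hnm
    calc smoothSobolevNorm g r p (U m - U n)
        ≤ smoothSobolevNorm g r p (U m - u m j) + smoothSobolevNorm g r p (u m j - U n) :=
          smoothSobolevNorm_sub_le g r hp _ _ _
      _ ≤ smoothSobolevNorm g r p (U m - u m j) + (smoothSobolevNorm g r p (u m j - u n j)
          + smoothSobolevNorm g r p (u n j - U n)) := by
          gcongr
          exact smoothSobolevNorm_sub_le g r hp _ _ _
      _ ≤ 2⁻¹ ^ n + (2 * 2⁻¹ ^ n + 2⁻¹ ^ n) := add_le_add (h1.trans h4) (add_le_add h2 h3)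
      _ = 4 * 2⁻¹ ^ n := by ring
  have hU' : ∀ N n m, N ≤ n → N ≤ m → smoothSobolevNorm g r p (U n - U m) ≤ 4 * 2⁻¹ ^ N := by
    intro N n m hn hm
    have hmono : ∀ k, N ≤ k → (4 * 2⁻¹ ^ k : ℝ≥0∞) ≤ 4 * 2⁻¹ ^ N := fun k hk =>
      mul_le_mul_right (pow_le_pow_right_of_le_one' (by simp) hk) _
    rcases le_total n m with h | h
    · rw [smoothSobolevNorm_sub_comm]
      exact (hU n m h).trans (hmono n hn)
    · exact (hU m n h).trans (hmono m hm)
  have hUfin : ∀ n, smoothSobolevNorm g r p (U n) < ⊤ := fun n => (hu n).finite _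
  have hULp : ∀ n, MemLp (U n) p (riemannianMeasure g) := fun n =>
    ⟨aestronglyMeasurable_smooth g _, (eLpNorm_le_smoothSobolevNorm g r p _).trans_lt (hUfin n)⟩
  -- `8` instead of `4`, because a strict bound is required.
  obtain ⟨h, hhLp, hh⟩ := Lp.cauchy_complete_eLpNorm (B := fun n => 8 * 2⁻¹ ^ n) hp hULp
    (by
      rw [ENNReal.tsum_mul_left, ENNReal.tsum_geometric]
      exact ENNReal.mul_ne_top (by simp) (by simp))
    (fun N n m hn hm => by
      have h1 : eLpNorm (⇑(U n) - ⇑(U m)) p (riemannianMeasure g) ≤ 4 * 2⁻¹ ^ N :=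
        (eLpNorm_le_smoothSobolevNorm g r p (U n - U m)).trans (hU' N n m hn hm)
      refine h1.trans_lt ?_
      have h0 : (2⁻¹ : ℝ≥0∞) ^ N ≠ 0 := (ENNReal.pow_pos (by simp) N).ne'
      have h0' : (2⁻¹ : ℝ≥0∞) ^ N ≠ ⊤ := ENNReal.pow_ne_top (by simp)
      exact (ENNReal.mul_lt_mul_iff_left h0 h0').2 (by norm_num))
  have hUh : IsSobolevApprox g r p U h := by
    refine ⟨hUfin, fun ε hε => ?_, hhLp.1, hh⟩
    obtain ⟨N, hN⟩ := exists_two_mul_inv_pow_le hε 4 (by simp)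
    exact ⟨N, fun m hm n hn => (hU' N m n hm hn).trans (hN N le_rfl)⟩
  refine ⟨h, ⟨U, hUh⟩, fun n => ?_⟩
  -- Along `J`, the difference of representatives is `u n (J m) - u m (J m)`, which `hdiff'` bounds
  -- for all `m ≥ n`.
  refine sobolevNorm_le_of_eventually
    (((hu n).comp (φ := J) fun m => le_max_left _ _).sub hp hUh) ?_
  filter_upwards [eventually_ge_atTop n] with m hm
  rw [Pi.sub_apply, smoothSobolevNorm_sub_comm]
  exact hdiff' (J m) n m hm

/-- The Sobolev space is complete. -/
theorem exists_limit_of_cauchy (hp : 1 ≤ p) {f : ℕ → M → ℝ} (hf : ∀ n, MemSobolev g r p (f n))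
    (hc : ∀ ε : ℝ≥0∞, 0 < ε → ∃ N, ∀ m ≥ N, ∀ n ≥ N,
      sobolevNorm g r p (fun x => f m x - f n x) ≤ ε) :
    ∃ h : M → ℝ, MemSobolev g r p h ∧
      Tendsto (fun n => sobolevNorm g r p (fun x => f n x - h x)) atTop (𝓝 0) := by
  choose N hN using fun k : ℕ => hc (2⁻¹ ^ (k + 1)) (ENNReal.pow_pos (by simp) _)
  -- Partial sums are monotone and dominate each `N k`. The exponent `k + 1` above provides the
  -- strict inequality of the fast Cauchy condition.
  set φ : ℕ → ℕ := fun k => ∑ i ∈ Finset.range (k + 1), N i with hφ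
  have hφN : ∀ k, N k ≤ φ k := fun k =>
    Finset.single_le_sum (f := N) (fun _ _ => Nat.zero_le _) (Finset.self_mem_range_succ k)
  have hφs : ∀ k, φ k ≤ φ (k + 1) := fun k => by
    simp only [hφ]; rw [Finset.sum_range_succ _ (k + 1)]; exact Nat.le_add_right _ _
  obtain ⟨h, hh, hlim⟩ := exists_limit_of_fast_cauchy hp (fun k => hf (φ k)) (fun k => by
    refine (hN k _ ((hφN k).trans (hφs k)) _ (hφN k)).trans_lt ?_
    rw [pow_succ]
    exact (ENNReal.mul_lt_mul_iff_right (ENNReal.pow_pos (by simp) k).ne'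
      (ENNReal.pow_ne_top (by simp))).2 (by simp) |>.trans_eq (mul_one _))
  refine ⟨h, hh, ENNReal.tendsto_atTop_zero.2 fun ε hε => ?_⟩
  obtain ⟨k, hk⟩ := exists_two_mul_inv_pow_le hε 3 (by simp)
  refine ⟨φ k, fun n hn => ?_⟩
  calc sobolevNorm g r p (fun x => f n x - h x)
      ≤ sobolevNorm g r p (fun x => f n x - f (φ k) x) +
        sobolevNorm g r p (fun x => f (φ k) x - h x) := sobolevNorm_sub_le hp _ _ _
    _ ≤ 2⁻¹ ^ (k + 1) + 2 * 2⁻¹ ^ k :=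
        add_le_add (hN k n ((hφN k).trans hn) _ (hφN k)) (hlim k)
    _ ≤ 2⁻¹ ^ k + 2 * 2⁻¹ ^ k := by
        gcongr ?_ + _
        exact pow_le_pow_right_of_le_one' (by simp) (Nat.le_succ k)
    _ = 3 * 2⁻¹ ^ k := by ring
    _ ≤ ε := hk k le_rfl

end Complete

/-! ### The local Sobolev space: cutoffs, gluing, seminorms, density -/

section LocalSobolev
variable {d : ℕ} {M : Type*} [TopologicalSpace M] [SecondCountableTopology M] [T2Space M]
  [ChartedSpace (Model d) M] [IsManifold (𝓡 d) ∞ M] [MeasurableSpace M] [BorelSpace M]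
variable {g : Metric d M} {r : ℕ} {p : ℝ≥0∞}

variable (d M) in
theorem exists_cutoffs [LocallyCompactSpace M] : ∃ (K : CompactExhaustion M)
    (χ : ℕ → TestFunction d M), (∀ n, ∀ x ∈ K n, (χ n).1 x = 1) ∧ ∀ n x, ‖(χ n).1 x‖ ≤ 1 := by
  have K : CompactExhaustion M := default
  have h := fun n => exists_contMDiffMap_one_nhds_of_subset_interior (n := ⊤) (𝓡 d)
    (K.isCompact n).isClosed (K.subset_interior_succ n)
  choose χ h1 h0 hI using h
  refine ⟨K, fun n => ⟨χ n, HasCompactSupport.intro (K.isCompact (n + 1)) (h0 n)⟩,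
    fun n x hx => (h1 n).self_of_nhdsSet x hx, fun n x => ?_⟩
  rw [Real.norm_of_nonneg (hI n x).1]
  exact (hI n x).2

theorem exists_mul_cutoff_eq {K : CompactExhaustion M} {χ : ℕ → TestFunction d M}
    (hχ : ∀ n, ∀ x ∈ K n, (χ n).1 x = 1) (η : TestFunction d M) :
    ∃ n₀, ∀ n ≥ n₀, ∀ x, η.1 x * (χ n).1 x = η.1 x := by
  obtain ⟨n₀, hn₀⟩ := K.exists_superset_of_isCompact η.2.isCompact
  refine ⟨n₀, fun n hn x => ?_⟩
  by_cases hx : x ∈ tsupport η.1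
  · rw [hχ n x (K.subset hn (hn₀ hx)), mul_one]
  · rw [image_eq_zero_of_notMem_tsupport hx, zero_mul]

theorem eLpNorm_cutoff_mul_le {ν : Measure M} {c : M → ℝ} (hc : ∀ x, ‖c x‖ ≤ 1) (f : M → ℝ) :
    eLpNorm (fun x => c x * f x) p ν ≤ eLpNorm f p ν :=
  eLpNorm_mono fun x => by
    rw [norm_mul]
    exact mul_le_of_le_one_left (norm_nonneg _) (hc x)

/-- Local limits glue. -/
theorem exists_local_limit [LocallyCompactSpace M] (hp : 1 ≤ p) {K : CompactExhaustion M}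
    {χ : ℕ → TestFunction d M} (hχ : ∀ n, ∀ x ∈ K n, (χ n).1 x = 1)
    (hχ1 : ∀ n x, ‖(χ n).1 x‖ ≤ 1) {f : ℕ → M → ℝ}
    (hf : ∀ k n, MemSobolev g r p (fun x => (χ k).1 x * f n x))
    (hc : ∀ k, ∀ ε : ℝ≥0∞, 0 < ε → ∃ N, ∀ m ≥ N, ∀ n ≥ N,
      sobolevNorm g r p (fun x => (χ k).1 x * f m x - (χ k).1 x * f n x) ≤ ε) :
    ∃ h : M → ℝ, AEStronglyMeasurable h (riemannianMeasure g) ∧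
      LocallyIntegrable h (riemannianMeasure g) ∧
      (∀ η : TestFunction d M, MemSobolev g r p (fun x => η.1 x * h x)) ∧
      ∀ k, Tendsto (fun n => sobolevNorm g r p
        (fun x => (χ k).1 x * f n x - (χ k).1 x * h x)) atTop (𝓝 0) := by
  choose G hG hGlim using fun k => exists_limit_of_cauchy hp (hf k) (hc k)
  have hGLp : ∀ k, MemLp (G k) p (riemannianMeasure g) := fun k => (hG k).memLp
  -- Both sides are `L^p` limits of `χ k * χ l * f n`, since the cutoffs are bounded by `1`.
  have hcompat : ∀ k l, (fun x => (χ k).1 x * G l x) =ᵐ[riemannianMeasure g]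
      fun x => (χ l).1 x * G k x := by
    intro k l
    have hmeas : AEStronglyMeasurable (fun x => (χ k).1 x * G l x - (χ l).1 x * G k x)
        (riemannianMeasure g) :=
      ((aestronglyMeasurable_smooth g _).mul (hGLp l).1).sub
        ((aestronglyMeasurable_smooth g _).mul (hGLp k).1)
    have h0 : eLpNorm (fun x => (χ k).1 x * G l x - (χ l).1 x * G k x) p
        (riemannianMeasure g) = 0 := by
      refine le_antisymm ?_ zero_le
      have h1 := (hGlim l).add (hGlim k)
      rw [add_zero] at h1
      refine ge_of_tendsto' h1 fun n => ?_
      have hml : AEStronglyMeasurable (fun x => (χ l).1 x * f n x - G l x)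
        (riemannianMeasure g) := ((hf l n).sub hp (hG l)).memLp.1
      have hmk : AEStronglyMeasurable (fun x => (χ k).1 x * f n x - G k x)
        (riemannianMeasure g) := ((hf k n).sub hp (hG k)).memLp.1
      calc eLpNorm (fun x => (χ k).1 x * G l x - (χ l).1 x * G k x) p (riemannianMeasure g)
          = eLpNorm ((fun x => (χ l).1 x * ((χ k).1 x * f n x - G k x)) -
              fun x => (χ k).1 x * ((χ l).1 x * f n x - G l x)) p (riemannianMeasure g) := by
            congr 1; ext x; simp only [Pi.sub_apply]; ring
        _ ≤ eLpNorm (fun x => (χ l).1 x * ((χ k).1 x * f n x - G k x)) p (riemannianMeasure g) +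
            eLpNorm (fun x => (χ k).1 x * ((χ l).1 x * f n x - G l x)) p (riemannianMeasure g) :=
            eLpNorm_sub_le ((aestronglyMeasurable_smooth g _).mul hmk)
              ((aestronglyMeasurable_smooth g _).mul hml) hp
        _ ≤ _ := by
            rw [add_comm]
            exact add_le_add
              ((eLpNorm_cutoff_mul_le (hχ1 k) _).trans (eLpNorm_le_sobolevNorm hp _))
              ((eLpNorm_cutoff_mul_le (hχ1 l) _).trans (eLpNorm_le_sobolevNorm hp _))
    have h1 := (eLpNorm_eq_zero_iff hmeas (zero_lt_one.trans_le hp).ne').1 h0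
    filter_upwards [h1] with x hx
    exact sub_eq_zero.1 hx
  -- At `x` use the first `K n` containing `x`; there `χ n = 1`, so `hcompat` gives `χ k * h = G k`
  -- almost everywhere.
  set h : M → ℝ := fun x => G (K.find x) x with hh
  have hloc : ∀ k, (fun x => (χ k).1 x * h x) =ᵐ[riemannianMeasure g] G k := by
    intro k
    filter_upwards [ae_all_iff.2 (hcompat k)] with x hx
    rw [hh]
    simp only [hx (K.find x), hχ _ x (K.mem_find x), one_mul]
  have hlim : ∀ x, Tendsto (fun k => (χ k).1 x * h x) atTop (𝓝 (h x)) := by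
    intro x
    refine tendsto_const_nhds.congr' ?_
    filter_upwards [eventually_ge_atTop (K.find x)] with k hk
    rw [hχ k x (K.mem_iff_find_le.2 hk), one_mul]
  have hη : ∀ η : TestFunction d M, MemSobolev g r p (fun x => η.1 x * h x) := by
    intro η
    obtain ⟨n, hn⟩ := exists_mul_cutoff_eq hχ η
    refine ((hG n).mul hp η.1 η.2).congr ?_
    filter_upwards [hloc n] with x hx
    rw [← hx, ← mul_assoc, hn n le_rfl]
  -- Measurability of `h` comes from the pointwise limit `χ k * h → h`, eventually constant at each
  -- point.
  refine ⟨h, aestronglyMeasurable_of_tendsto_ae atTop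
    (fun k => (hGLp k).1.congr (hloc k).symm) (ae_of_all _ hlim), ?_, hη, fun k => ?_⟩
  · refine locallyIntegrable_iff.2 fun s hs => ?_
    obtain ⟨n, hn⟩ := K.exists_superset_of_isCompact hs
    have : IsFiniteMeasure ((riemannianMeasure g).restrict s) :=
      ⟨by rw [Measure.restrict_apply_univ]; exact hs.measure_lt_top⟩
    have h1 : Integrable (G n) ((riemannianMeasure g).restrict s) :=
      ((hGLp n).restrict s).integrable hp
    refine h1.congr ?_
    filter_upwards [ae_restrict_of_ae (hloc n), ae_restrict_mem hs.measurableSet] with x hx hxs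
    rw [← hx, hχ n x (hn hxs), one_mul]
  · refine (hGlim k).congr fun n => sobolevNorm_congr ?_
    filter_upwards [hloc k] with x hx
    rw [hx]

theorem locallyIntegrable_congr_ae {X : Type*} [TopologicalSpace X] [MeasurableSpace X]
    {ν : Measure X} {f h : X → ℝ} (hf : LocallyIntegrable f ν) (hfh : f =ᵐ[ν] h) :
    LocallyIntegrable h ν := fun x => by
  obtain ⟨s, hs, hfs⟩ := hf x
  exact ⟨s, hs, hfs.congr_fun_ae (ae_restrict_of_ae hfh)⟩

variable (g r) in
/-- The local Sobolev space as a linear subspace. -/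
def localSobolevSubmodule (hp : 1 ≤ p) : Submodule ℝ (M →ₘ[riemannianMeasure g] ℝ) where
  carrier := localSobolev g r p
  add_mem' {a b} ha hb := by
    have hab := AEEqFun.coeFn_add a b
    refine ⟨locallyIntegrable_congr_ae (ha.1.add hb.1) hab.symm, fun η hη => ?_⟩
    refine ((ha.2 η hη).add hp (hb.2 η hη)).congr ?_
    filter_upwards [hab] with x hx
    rw [hx, Pi.add_apply, mul_add]
  zero_mem' := by
    have h0 : (⇑(0 : M →ₘ[riemannianMeasure g] ℝ)) =ᵐ[riemannianMeasure g] fun _ => 0 :=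
      AEEqFun.coeFn_zero
    refine ⟨locallyIntegrable_congr_ae locallyIntegrable_zero h0.symm, fun η hη => ?_⟩
    refine (memSobolev_of_smooth (w := 0)
      (by rw [smoothSobolevNorm_zero]; exact ENNReal.zero_lt_top)).congr ?_
    filter_upwards [h0] with x hx
    simp [hx]
  smul_mem' c a ha := by
    have hca := AEEqFun.coeFn_smul c a
    refine ⟨locallyIntegrable_congr_ae (ha.1.smul c) hca.symm, fun η hη => ?_⟩
    refine ((ha.2 η hη).smul c).congr ?_
    filter_upwards [hca] with x hx
    rw [hx, Pi.smul_apply, smul_eq_mul]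
    ring

theorem memSobolev_mul_coe (hp : 1 ≤ p) (η : TestFunction d M) (f : localSobolevSubmodule g r hp) :
    MemSobolev g r p (fun x => η.1 x * f.1 x) := f.2.2 η.1 η.2

theorem mul_coe_sub_ae (hp : 1 ≤ p) (η : TestFunction d M) (f h : localSobolevSubmodule g r hp) :
    (fun x => η.1 x * (f - h).1 x) =ᵐ[riemannianMeasure g]
      fun x => η.1 x * f.1 x - η.1 x * h.1 x := by
  filter_upwards [AEEqFun.coeFn_sub f.1 h.1] with x hx
  rw [Submodule.coe_sub, hx, Pi.sub_apply, mul_sub]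

variable (g r) in
/-- The seminorms `f ↦ ‖η f‖_{W^r_p}`. -/
def localSeminorm (hp : 1 ≤ p) : SeminormFamily ℝ (localSobolevSubmodule g r hp) (TestFunction d M) :=
  -- Only `‖c f‖ ≤ |c| ‖f‖` has to be shown; the reverse follows by scaling with `c⁻¹`.
  fun η => Seminorm.ofSMulLE (fun f => (sobolevNorm g r p (fun x => η.1 x * f.1 x)).toReal)
    (by
      have h0 : (fun x => η.1 x * (0 : M →ₘ[riemannianMeasure g] ℝ) x) =ᵐ[riemannianMeasure g]
          fun _ => 0 := by
        filter_upwards [AEEqFun.coeFn_zero (β := ℝ) (μ := riemannianMeasure g)] with x hx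
        rw [hx, Pi.zero_apply, mul_zero]
      rw [Submodule.coe_zero, sobolevNorm_congr h0, sobolevNorm_zero, ENNReal.toReal_zero])
    (fun f h => by
      have hfh : (fun x => η.1 x * (f + h).1 x) =ᵐ[riemannianMeasure g]
          fun x => η.1 x * f.1 x + η.1 x * h.1 x := by
        filter_upwards [AEEqFun.coeFn_add f.1 h.1] with x hx
        rw [Submodule.coe_add, hx, Pi.add_apply, mul_add]
      have hf' := (memSobolev_mul_coe hp η f).sobolevNorm_lt_top hp
      have hh' := (memSobolev_mul_coe hp η h).sobolevNorm_lt_top hp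
      rw [sobolevNorm_congr hfh, ← ENNReal.toReal_add hf'.ne hh'.ne]
      exact ENNReal.toReal_mono (ENNReal.add_ne_top.2 ⟨hf'.ne, hh'.ne⟩) (sobolevNorm_add_le hp _ _))
    (fun c f => by
      have hcf : (fun x => η.1 x * (c • f).1 x) =ᵐ[riemannianMeasure g]
          fun x => c * (η.1 x * f.1 x) := by
        filter_upwards [AEEqFun.coeFn_smul c f.1] with x hx
        rw [Submodule.coe_smul, hx, Pi.smul_apply, smul_eq_mul]
        ring
      have hf' := (memSobolev_mul_coe hp η f).sobolevNorm_lt_top hp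
      rw [sobolevNorm_congr hcf, ← toReal_enorm, ← ENNReal.toReal_mul]
      exact ENNReal.toReal_mono (ENNReal.mul_ne_top enorm_ne_top hf'.ne)
        (sobolevNorm_smul_le hp c (memSobolev_mul_coe hp η f)))

theorem ofReal_localSeminorm (hp : 1 ≤ p) (η : TestFunction d M)
    (f : localSobolevSubmodule g r hp) :
    ENNReal.ofReal (localSeminorm g r hp η f) = sobolevNorm g r p (fun x => η.1 x * f.1 x) :=
  ENNReal.ofReal_toReal ((memSobolev_mul_coe hp η f).sobolevNorm_lt_top hp).ne

theorem ofReal_localSeminorm_sub (hp : 1 ≤ p) (η : TestFunction d M)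
    (f h : localSobolevSubmodule g r hp) : ENNReal.ofReal (localSeminorm g r hp η (f - h)) =
      sobolevNorm g r p (fun x => η.1 x * f.1 x - η.1 x * h.1 x) := by
  rw [ofReal_localSeminorm, sobolevNorm_congr (mul_coe_sub_ae hp η f h)]

/-- Here `η f = η (χ f)`, and multiplication by `η` is bounded on `W^r_p`. -/
theorem localSeminorm_le_mul (hp : 1 ≤ p) {χ η : TestFunction d M}
    (hηχ : ∀ x, η.1 x * χ.1 x = η.1 x) :
    ∃ C : ℝ, ∀ f, localSeminorm g r hp η f ≤ C * localSeminorm g r hp χ f := by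
  obtain ⟨C, hC, hle⟩ := exists_sobolevNorm_mul_le g r hp η.1 η.2
  refine ⟨C.toReal, fun f => ?_⟩
  have h1 := hle _ (memSobolev_mul_coe hp χ f)
  simp only [← mul_assoc, hηχ] at h1
  rw [← ofReal_localSeminorm hp, ← ofReal_localSeminorm hp, ← ENNReal.ofReal_toReal hC,
    ← ENNReal.ofReal_mul ENNReal.toReal_nonneg] at h1
  exact (ENNReal.ofReal_le_ofReal_iff
    (mul_nonneg ENNReal.toReal_nonneg (apply_nonneg _ _))).1 h1

theorem withSeminorms_localSeminorm (hp : 1 ≤ p) {K : CompactExhaustion M}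
    {χ : ℕ → TestFunction d M} (hχ : ∀ n, ∀ x ∈ K n, (χ n).1 x = 1)
    [TopologicalSpace (localSobolevSubmodule g r hp)]
    (hq : WithSeminorms fun n => localSeminorm g r hp (χ n)) :
    WithSeminorms (localSeminorm g r hp) := by
  refine hq.congr (.of_real fun η => ?_) (.of_real fun n => ⟨{χ n}, 1, fun f => by simp⟩)
  obtain ⟨n, hn⟩ := exists_mul_cutoff_eq hχ η
  obtain ⟨C, hC⟩ := localSeminorm_le_mul (g := g) (r := r) hp (hn n le_rfl)
  exact ⟨{n}, C, fun f => by simpa using hC f⟩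

/-- The `L^p` norm of `χ n * f` vanishes for every `n`; hence `f = 0` almost everywhere on each `K
n`, and these cover `M`. -/
theorem eq_zero_of_localSeminorm_eq_zero (hp : 1 ≤ p) {K : CompactExhaustion M}
    {χ : ℕ → TestFunction d M} (hχ : ∀ n, ∀ x ∈ K n, (χ n).1 x = 1)
    {f : localSobolevSubmodule g r hp} (hf : ∀ n, localSeminorm g r hp (χ n) f = 0) : f = 0 := by
  have h1 : ∀ n, (fun x => (χ n).1 x * f.1 x) =ᵐ[riemannianMeasure g] 0 := by
    intro n
    rw [← eLpNorm_eq_zero_iff (memSobolev_mul_coe hp (χ n) f).memLp.1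
      (zero_lt_one.trans_le hp).ne']
    refine le_antisymm ((eLpNorm_le_sobolevNorm (r := r) hp _).trans ?_) zero_le
    rw [← ofReal_localSeminorm hp, hf n, ENNReal.ofReal_zero]
  refine Subtype.ext (AEEqFun.ext ?_)
  filter_upwards [ae_all_iff.2 h1, AEEqFun.coeFn_zero (β := ℝ) (μ := riemannianMeasure g)]
    with x hx h0
  have h2 := hx (K.find x)
  rw [hχ _ x (K.mem_find x), one_mul] at h2
  rw [h2, Submodule.coe_zero, h0]

theorem exists_coe_ae_eq_testFunction [LocallyCompactSpace M] (hp : 1 ≤ p) (φ : TestFunction d M) :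
    ∃ f : localSobolevSubmodule g r hp, f.1 =ᵐ[riemannianMeasure g] φ.1 := by
  have hc : Continuous φ.1 := φ.1.contMDiff.continuous
  have hφ := AEEqFun.coeFn_mk φ.1 (aestronglyMeasurable_smooth g φ.1)
  refine ⟨⟨AEEqFun.mk φ.1 (aestronglyMeasurable_smooth g φ.1), ?_, fun η hη => ?_⟩, hφ⟩
  · exact locallyIntegrable_congr_ae (hc.locallyIntegrable) hφ.symm
  · have h1 : MemSobolev g r p (η * φ.1 : C^∞⟮𝓡 d, M; ℝ⟯) :=
      memSobolev_of_smooth (smoothSobolevNorm_lt_top g r p _ (φ.2.mul_left))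
    refine h1.congr ?_
    filter_upwards [hφ] with x hx
    rw [hx]
    rfl

theorem exists_tendsto_of_cauchy [LocallyCompactSpace M] (hp : 1 ≤ p) {K : CompactExhaustion M}
    {χ : ℕ → TestFunction d M} (hχ : ∀ n, ∀ x ∈ K n, (χ n).1 x = 1)
    (hχ1 : ∀ n x, ‖(χ n).1 x‖ ≤ 1) (f : ℕ → localSobolevSubmodule g r hp)
    (hc : ∀ k, ∀ ε : ℝ, 0 < ε → ∃ N, ∀ m ≥ N, ∀ n ≥ N,
      localSeminorm g r hp (χ k) (f m - f n) < ε) :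
    ∃ h : localSobolevSubmodule g r hp, ∀ k, ∀ ε : ℝ, 0 < ε → ∃ N, ∀ n, N ≤ n →
      localSeminorm g r hp (χ k) (f n - h) < ε := by
  obtain ⟨h, hm, hint, hη, hlim⟩ := exists_local_limit (f := fun n => f n) hp hχ hχ1
    (fun k n => memSobolev_mul_coe hp (χ k) (f n)) (fun k ε hε => by
      by_cases hε' : ε = ⊤
      · exact ⟨0, fun m _ n _ => hε' ▸ le_top⟩
      obtain ⟨N, hN⟩ := hc k ε.toReal (ENNReal.toReal_pos hε.ne' hε')
      refine ⟨N, fun m hm n hn => ?_⟩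
      rw [← ofReal_localSeminorm_sub hp]
      exact ENNReal.ofReal_le_of_le_toReal (hN m hm n hn).le)
  have hh := AEEqFun.coeFn_mk h hm
  refine ⟨⟨AEEqFun.mk h hm, locallyIntegrable_congr_ae hint hh.symm, fun η hηc => ?_⟩,
    fun k ε hε => ?_⟩
  · refine (hη ⟨η, hηc⟩).congr ?_
    filter_upwards [hh] with x hx
    rw [hx]
  · obtain ⟨N, hN⟩ := eventually_atTop.1
      ((hlim k).eventually (gt_mem_nhds (ENNReal.ofReal_pos.2 hε)))
    refine ⟨N, fun n hn => ?_⟩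
    rw [← ENNReal.ofReal_lt_ofReal_iff hε, ofReal_localSeminorm_sub hp]
    refine lt_of_eq_of_lt (sobolevNorm_congr ?_) (hN n hn)
    filter_upwards [hh] with x hx
    rw [hx]

theorem exists_testFunction_tendsto [LocallyCompactSpace M] (hp : 1 ≤ p)
    {K : CompactExhaustion M} {χ : ℕ → TestFunction d M} (hχ : ∀ n, ∀ x ∈ K n, (χ n).1 x = 1)
    (f : localSobolevSubmodule g r hp) :
    ∃ w : ℕ → localSobolevSubmodule g r hp,
      (∀ n, ∃ φ : TestFunction d M, (w n).1 =ᵐ[riemannianMeasure g] φ.1) ∧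
      ∀ k, ∀ ε : ℝ, 0 < ε → ∃ N, ∀ n, N ≤ n → localSeminorm g r hp (χ k) (w n - f) < ε := by
  choose u hufin hu using fun n => exists_smooth_sobolevNorm_sub_le hp
    (memSobolev_mul_coe hp (χ n) f) (ENNReal.pow_pos (a := 2⁻¹) (by simp) n)
  -- For large `n`, `χ k χ n = χ k`, so `χ k (f - φ n) = χ k (χ n f - u n)`, whose norm is at most
  -- `C * 2⁻¹ ^ n`.
  set φ : ℕ → TestFunction d M := fun n => ⟨(χ n).1 * u n, (χ n).2.mul_right⟩ with hφ
  choose w hw using fun n => exists_coe_ae_eq_testFunction (g := g) (r := r) hp (φ n)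
  refine ⟨w, fun n => ⟨φ n, hw n⟩, fun k ε hε => ?_⟩
  obtain ⟨C, hC, hle⟩ := exists_sobolevNorm_mul_le g r hp (χ k).1 (χ k).2
  obtain ⟨n₀, hn₀⟩ := exists_mul_cutoff_eq hχ (χ k)
  obtain ⟨N, hN⟩ := exists_two_mul_inv_pow_le (ε := ENNReal.ofReal (ε / 2))
    (ENNReal.ofReal_pos.2 (half_pos hε)) C hC
  refine ⟨max n₀ N, fun n hn => ?_⟩
  have hn0 := hn₀ n (le_of_max_le_left hn)
  rw [← ENNReal.ofReal_lt_ofReal_iff hε, map_sub_rev, ofReal_localSeminorm_sub hp]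
  have h1 : (fun x => (χ k).1 x * f.1 x - (χ k).1 x * (w n).1 x) =ᵐ[riemannianMeasure g]
      fun x => (χ k).1 x * ((χ n).1 x * f.1 x - u n x) := by
    filter_upwards [hw n] with x hx
    have h2 : (φ n).1 x = (χ n).1 x * u n x := rfl
    rw [hx, h2, mul_sub, ← mul_assoc, ← mul_assoc, hn0]
  rw [sobolevNorm_congr h1]
  calc _ ≤ C * sobolevNorm g r p (fun x => (χ n).1 x * f.1 x - u n x) :=
        hle _ ((memSobolev_mul_coe hp (χ n) f).sub hp (memSobolev_of_smooth (hufin n)))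
    _ ≤ C * 2⁻¹ ^ n := mul_le_mul_right (hu n) _
    _ ≤ ENNReal.ofReal (ε / 2) := hN n (le_of_max_le_right hn)
    _ < ENNReal.ofReal ε := (ENNReal.ofReal_lt_ofReal_iff hε).2 (half_lt_self hε)

end LocalSobolev

/-! ### Fréchet spaces from countable families of seminorms -/

section Frechet

variable {E ι : Type*} [AddCommGroup E] [Module ℝ E] [UniformSpace E] [IsUniformAddGroup E]
  [Countable ι] {q : SeminormFamily ℝ E ι}

/-- A criterion for Fréchet spaces: countably many seminorms, which separate points, and
for which Cauchy sequences converge. -/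
theorem isFrechetSpace_of_withSeminorms (hq : WithSeminorms q)
    (hsep : ∀ x, (∀ i, q i x = 0) → x = 0)
    (hcomplete : ∀ f : ℕ → E, (∀ i, ∀ ε : ℝ, 0 < ε → ∃ N, ∀ m ≥ N, ∀ n ≥ N, q i (f m - f n) < ε) →
      ∃ h, ∀ i, ∀ ε : ℝ, 0 < ε → ∃ N, ∀ n, N ≤ n → q i (f n - h) < ε) :
    IsFrechetSpace E := by
  -- Countability of the family makes the uniformity countably generated: with separation this gives
  -- metrizability, and completeness may be tested on sequences.
  have := hq.firstCountableTopology
  have : (uniformity E).IsCountablyGenerated := IsUniformAddGroup.uniformity_countably_generated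
  have : T1Space E := hq.T1_of_separating fun x hx => by
    by_contra! h
    exact hx (hsep x h)
  refine ⟨inferInstance, hq.continuousSMul, hq.toLocallyConvexSpace,
    UniformSpace.metrizableSpace, UniformSpace.complete_of_cauchySeq_tendsto fun f hf => ?_⟩
  obtain ⟨h, hh⟩ := hcomplete f fun i ε hε => by
    have h1 : {x : E × E | q i (x.1 - x.2) < ε} ∈ uniformity E := by
      rw [uniformity_eq_comap_nhds_zero_swapped]
      refine ⟨{x | q i x < ε}, ?_, fun x hx => hx⟩
      exact (isOpen_lt (hq.continuous_seminorm i) continuous_const).mem_nhds (by simpa using hε)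
    exact cauchySeq_iff.1 hf _ h1
  exact ⟨h, (hq.tendsto_nhds_atTop f h).2 hh⟩

end Frechet
end LocSob
end
-- The main theorem
open LocSob in
/-- `W^r_{p,loc}(M)` is a linear subspace `W` of the space of classes of measurable functions, the
maps `f ↦ ‖η f‖_{W^r_p}`, `η ∈ C_c^∞(M)`, are seminorms `ϱ η` on it, `W` with the topology that
these seminorms generate is a Fréchet space, and `C_c^∞(M)` is contained in `W` and dense. -/
theorem mainTheorem10 {d : ℕ} {M : Type*} [TopologicalSpace M] [T2Space M]
    [SecondCountableTopology M] [NoncompactSpace M] [ChartedSpace (Model d) M]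
    [IsManifold (𝓡 d) ∞ M] [MeasurableSpace M] [BorelSpace M] (g : Metric d M)
    (r : ℕ) (hr : 1 ≤ r) (p : ℝ≥0∞) (hp1 : 1 ≤ p) (hp : p ≠ ⊤) :
    ∃ (W : Submodule ℝ (M →ₘ[riemannianMeasure g] ℝ))
      (ϱ : SeminormFamily ℝ W (TestFunction d M)) (_ : UniformSpace W),
      (W : Set (M →ₘ[riemannianMeasure g] ℝ)) = localSobolev g r p ∧
      (∀ (η : TestFunction d M) (f : W),
        ENNReal.ofReal (ϱ η f) = sobolevNorm g r p (fun x => η.1 x * f.1 x)) ∧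
      WithSeminorms ϱ ∧
      IsFrechetSpace W ∧
      (∀ φ : TestFunction d M, ∃ f : W, f.1 =ᵐ[riemannianMeasure g] φ.1) ∧
      Dense {f : W | ∃ φ : TestFunction d M, f.1 =ᵐ[riemannianMeasure g] φ.1} := by
  have : LocallyCompactSpace M := ChartedSpace.locallyCompactSpace (Model d) M
  obtain ⟨K, χ, hχ, hχ1⟩ := exists_cutoffs d M
  set q : SeminormFamily ℝ (localSobolevSubmodule g r hp1) ℕ :=
    fun n => localSeminorm g r hp1 (χ n) with hq_def
  -- The topology is defined by the countable family of cutoffs and only afterwards identified with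
  -- that of all `ϱ η`.
  let τ : TopologicalSpace (localSobolevSubmodule g r hp1) := q.moduleFilterBasis.topology
  have hq : WithSeminorms q := ⟨rfl⟩
  have : IsTopologicalAddGroup (localSobolevSubmodule g r hp1) := hq.topologicalAddGroup
  let U : UniformSpace (localSobolevSubmodule g r hp1) :=
    IsTopologicalAddGroup.rightUniformSpace _
  have : IsUniformAddGroup (localSobolevSubmodule g r hp1) := isUniformAddGroup_of_addCommGroup
  refine ⟨localSobolevSubmodule g r hp1, localSeminorm g r hp1, U, rfl,
    ofReal_localSeminorm hp1, withSeminorms_localSeminorm hp1 hχ hq,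
    isFrechetSpace_of_withSeminorms hq
      (fun f hf => eq_zero_of_localSeminorm_eq_zero hp1 hχ hf)
      (exists_tendsto_of_cauchy hp1 hχ hχ1),
    exists_coe_ae_eq_testFunction hp1, fun f => ?_⟩
  obtain ⟨w, hw, hlim⟩ := exists_testFunction_tendsto hp1 hχ f
  exact mem_closure_of_tendsto ((hq.tendsto_nhds_atTop w f).2 hlim) (Eventually.of_forall hw)
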